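/- **Setting.** Let $k$ be a field and $P$ a finite quiver whose arrows $a$ (with tail $t(a)$ and head $h(a)$) have weights $|a|\in\{0,1,2\}$. Let $\overline P$ be its double of weight $2$: a reverse arrow $a^*$ with $|a^*|=2-|a|$ is added for each arrow $a$ of $P$, and $(a^*)^*=a$. Let $A=k\overline P$ be the path algebra (arrows composed from right to left), graded by weight, $R\subset A$ the span of the trivial paths $e_i$, $B\subset A$ the path algebra of the weight $0$ subquiver, and $E_1=\bigoplus_{|a|=1}BaB\subset A$. For $S=R,B$ let $\Omega^1_SA=\ker(A\otimes_SA\to A)$, $\mathrm d a=1\otimes a-a\otimes 1$. Let $E_1^\vee=\operatorname{Hom}_{B^e}(E_1,B\otimes B)$ (outer structure on $B\otimes B$), a $B$-bimodule through the inner structure. For an arrow $a$ of weight $1$ let $\widetilde a\in E_1^\vee$ be the element with $\widetilde a(a)=e_{h(a)}\otimes e_{t(a)}$ and $\widetilde a(b)=0$ for all other arrows $b$ of weight $1$. **Signs.** Fix one of two Koszul sign rules. Interchanging homogeneous elements $u,v$ of weights $|u|,|v|$ and form degrees $\|u\|,\|v\|$ costs the sign $(-1)^{\kappa|u||v|+\|u\|\|v\|}$,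 with $\kappa=1$ (bigraded rule) or $\kappa=0$ (only form degrees count). All of the following uses the chosen rule. A double derivation of weight $n$ is a $k$-linear map $\Theta\colon A\to A\otimes A$ of weight $n$ with $\Theta(R)=0$ and $\Theta(xy)=\Theta(x)y+(-1)^{\kappa n|x|}x\Theta(y)$; $\mathbb D\mathrm{er}_RA$ is the direct sum over $n\in\mathbb Z$ of the spaces of these, with the graded $A$-bimodule structure induced by the inner one on $A\otimes A$. $\mathrm{DR}^2A$ is the degree $2$ part of $T_A\Omega^1_RA$ modulo graded commutators, and $\iota_\Theta\colon\mathrm{DR}^2A\to\Omega^1_RA$ is the reduced contraction: $i_\Theta(\alpha\beta)=i_\Theta(\alpha)\beta-(-1)^{\kappa n|\alpha|}\alpha\, i_\Theta(\beta)$, where $i_\Theta(x(\mathrm d y)z)=(-1)^{\kappa n|x|}x\Theta(y)z$, followed by $u\otimes v\mapsto\pm vu$ with the sign of the rule. Let $\omega=\sum_{a\in P_1}\mathrm da\,\mathrm da^*\in\mathrm{DR}^2A$ and $\iota(\omega)(\Theta)=\iota_\Theta\omega$. For an arrow $a$ of $\overline P$ of weight $1$ put $$\varepsilon_\kappa(a)=1\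 \text{ if } a\in P_1,\qquad \varepsilon_\kappa(a)=-(-1)^{\kappa}\ \text{ if } a\in \overline P_1\setminus P_1 .$$ So $\varepsilon_0$ is the usual function $\varepsilon$ ($1$ on $P_1$ and $-1$ on the reverse arrows), and $\varepsilon_1=1$. **Theorem.** 1. $\iota(\omega)\colon\mathbb D\mathrm{er}_RA\to\Omega^1_RA$ is an isomorphism of graded $A$-bimodules that raises weights by $2$. 2. The elements $\widetilde a$ exist and are unique. Each $\varphi\in E_1^\vee$ extends uniquely to a double derivation $J(\varphi)\in\mathbb D\mathrm{er}_RA$ of weight $-1$ that vanishes on the arrows of weight $2$; and $E_1\to\Omega^1_BA$, $e\mapsto\mathrm d e$, is injective. 3. In weight $1$, $\iota(\omega)$ restricts to an isomorphism of $B$-bimodules $(\iota(\omega))_1\colon E_1^\vee\to E_1$. That is, for all $\varphi\in E_1^\vee$ the image of $\iota(\omega)(J(\varphi))$ in $\Omega^1_BA$ is $\mathrm d$ of $(\iota(\omega))_1(\varphi)\in E_1$. For each arrow $a$ of weight $1$, $$\iota(\omega)(J(\widetilde a))=\varepsilon_\kappa(a)\,\mathrm da^*\in\Omega^1_RA,\qquad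 (\iota(\omega))_1(\widetilde a)=\varepsilon_\kappa(a)\,a^*,$$ and the inverse $\flat\colon E_1\to E_1^\vee$ satisfies $\flat(a)=\varepsilon_\kappa(a^*)\,\widetilde{a^*}$. -/

import Mathlib

open scoped TensorProduct DirectSum

noncomputable section

set_option linter.unusedSectionVars false

namespace NCQuiver

/-! ### Graded quivers, double graded quivers, paths -/

/-- A graded quiver with vertex set `V` and arrow set `E`: tail, head and weight of each arrow. -/
structure GradedQuiver (V E : Type*) where
  tail : E → V
  head : E → V
  wt : E → ℕ

/-- The weight `N` double graded quiver: `Sum.inl a` is the arrow `a`, and `Sum.inr a` is the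
reverse arrow `a*`, of weight `N - |a|` (used only when `|a| ≤ N` for all `a`). -/
def GradedQuiver.double {V E : Type*} (P : GradedQuiver V E) (N : ℕ) : GradedQuiver V (E ⊕ E) where
  tail := Sum.elim P.tail P.head
  head := Sum.elim P.head P.tail
  wt := Sum.elim P.wt (fun a => N - P.wt a)

/-- The involution `a ↦ a*` on the arrows of a double quiver. -/
def star {E : Type*} : E ⊕ E → E ⊕ E := Sum.swap

/-- `IsWalk Q i [a_l, ..., a_1] j` says that `a_l ⋯ a_1` is a path with head `i` and tail `j`. -/
def IsWalk {V E : Type*} (Q : GradedQuiver V E) : V → List E → V → Prop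
  | i, [], j => i = j
  | i, a :: l, j => Q.head a = i ∧ IsWalk Q (Q.tail a) l j

/-- A path `a_l ⋯ a_1` (arrows composed from right to left); the trivial path at `i` has an empty
list of arrows and head and tail `i`. -/
@[ext]
structure Path {V E : Type*} (Q : GradedQuiver V E) where
  head : V
  arrows : List E
  tail : V
  isWalk : IsWalk Q head arrows tail

theorem IsWalk.append {V E : Type*} {Q : GradedQuiver V E} {j m : V} {l' : List E}
    (h' : IsWalk Q j l' m) : ∀ {i : V} {l : List E}, IsWalk Q i l j → IsWalk Q i (l ++ l') m
  | _, [], h => by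
      have h : _ = _ := h
      subst h; exact h'
  | _, _ :: _, h => ⟨h.1, IsWalk.append h' h.2⟩

section Paths
variable {V E : Type*} {Q : GradedQuiver V E}

/-- The trivial path `e_i`. -/
def Path.triv (Q : GradedQuiver V E) (i : V) : Path Q := ⟨i, [], i, rfl⟩

/-- An arrow as a path of length one. -/
def Path.ofArrow (Q : GradedQuiver V E) (a : E) : Path Q := ⟨Q.head a, [a], Q.tail a, rfl, rfl⟩

/-- Concatenation `p q`, defined when `t(p) = h(q)`. -/
def Path.comp (p q : Path Q) (h : p.tail = q.head) : Path Q :=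
  ⟨p.head, p.arrows ++ q.arrows, q.tail, IsWalk.append q.isWalk (h ▸ p.isWalk)⟩

/-- The weight of a path is the sum of the weights of its arrows. -/
def Path.wt (p : Path Q) : ℕ := (p.arrows.map Q.wt).sum

end Paths

/-! ### The graded path algebra -/

/-- The path algebra: the vector space with basis all the paths. -/
def PathAlg (k : Type*) [Field k] {V E : Type*} (Q : GradedQuiver V E) : Type _ := Path Q →₀ k

section PathAlg
variable {k : Type*} [Field k] {V E : Type*} {Q : GradedQuiver V E}

instance : AddCommGroup (PathAlg k Q) := inferInstanceAs (AddCommGroup (Path Q →₀ k))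
instance : Module k (PathAlg k Q) := inferInstanceAs (Module k (Path Q →₀ k))

/-- The basis element of the path algebra given by a path. -/
def path (k : Type*) [Field k] {V E : Type*} {Q : GradedQuiver V E} (p : Path Q) : PathAlg k Q :=
  Finsupp.single p (1 : k)

/-- The linear map on the path algebra with prescribed values on the basis of paths. -/
def extend {M : Type*} [AddCommGroup M] [Module k M] (f : Path Q → M) : PathAlg k Q →ₗ[k] M :=
  Finsupp.linearCombination k f

@[simp] theorem extend_path {M : Type*} [AddCommGroup M] [Module k M] (f : Path Q → M)
    (p : Path Q) : extend f (path k p) = f p :=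
  (Finsupp.linearCombination_single k (1 : k) p).trans (one_smul k (f p))

theorem hom_ext {M : Type*} [AddCommGroup M] [Module k M] {f g : PathAlg k Q →ₗ[k] M}
    (h : ∀ p, f (path k p) = g (path k p)) : f = g :=
  Finsupp.lhom_ext' fun p => LinearMap.ext_ring (h p)

/-- An arrow, as an element of the path algebra. -/
def arrow (k : Type*) [Field k] {V E : Type*} (Q : GradedQuiver V E) (a : E) : PathAlg k Q :=
  path k (Path.ofArrow Q a)

/-- The idempotent `e_i`. -/
def idem (k : Type*) [Field k] {V E : Type*} (Q : GradedQuiver V E) (i : V) : PathAlg k Q :=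
  path k (Path.triv Q i)

theorem alg_induction {motive : PathAlg k Q → Prop} (x : PathAlg k Q)
    (h0 : motive 0) (hadd : ∀ y z, motive y → motive z → motive (y + z))
    (hpath : ∀ (c : k) (p : Path Q), motive (c • path k p)) : motive x := by
  refine Finsupp.induction_linear (motive := motive) x h0 hadd fun p c => ?_
  have : (Finsupp.single p c : Path Q →₀ k) = c • Finsupp.single p (1 : k) := by simp
  rw [this]
  exact hpath c p

variable [DecidableEq V]

/-- The product of two paths: their concatenation if `t(p) = h(q)`, and `0` otherwise. -/
def pathMul (k : Type*) [Field k] {V E : Type*} {Q : GradedQuiver V E} [DecidableEq V]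
    (p q : Path Q) : PathAlg k Q :=
  if h : p.tail = q.head then path k (p.comp q h) else 0

/-- The multiplication of the path algebra as a bilinear map. -/
def mulBilin (k : Type*) [Field k] {V E : Type*} (Q : GradedQuiver V E) [DecidableEq V] :
    PathAlg k Q →ₗ[k] PathAlg k Q →ₗ[k] PathAlg k Q :=
  extend fun p => extend fun q => pathMul k p q

instance : Mul (PathAlg k Q) := ⟨fun x y => mulBilin k Q x y⟩

theorem mul_def (x y : PathAlg k Q) : x * y = mulBilin k Q x y := rfl

theorem path_mul_path (p q : Path Q) : path k p * path k q = pathMul k p q := by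
  simp [mul_def, mulBilin]

theorem path_mul_path_of_eq (p q : Path Q) (h : p.tail = q.head) :
    path k p * path k q = path k (p.comp q h) := by
  rw [path_mul_path, pathMul, dif_pos h]

theorem path_mul_path_of_ne (p q : Path Q) (h : p.tail ≠ q.head) :
    path k p * path k q = 0 := by
  rw [path_mul_path, pathMul, dif_neg h]

instance : NonUnitalNonAssocRing (PathAlg k Q) where
  left_distrib x y z := by simp [mul_def]
  right_distrib x y z := by simp [mul_def]
  zero_mul x := by simp [mul_def]
  mul_zero x := by simp [mul_def]

theorem alg_smul_mul (c : k) (x y : PathAlg k Q) : c • x * y = c • (x * y) := by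
  simp [mul_def]

theorem alg_mul_smul (c : k) (x y : PathAlg k Q) : x * c • y = c • (x * y) := by
  simp [mul_def]

theorem path_mul_assoc (p q r : Path Q) :
    path k p * path k q * path k r = path k p * (path k q * path k r) := by
  by_cases h : p.tail = q.head <;> by_cases h' : q.tail = r.head
  · rw [path_mul_path_of_eq p q h, path_mul_path_of_eq q r h',
      path_mul_path_of_eq (p.comp q h) r h', path_mul_path_of_eq p (q.comp r h') h]
    congr 1
    ext1 <;> simp [Path.comp]
  · rw [path_mul_path_of_eq p q h, path_mul_path_of_ne q r h',
      path_mul_path_of_ne (p.comp q h) r h', mul_zero]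
  · rw [path_mul_path_of_ne p q h, path_mul_path_of_eq q r h',
      path_mul_path_of_ne p (q.comp r h') h, zero_mul]
  · rw [path_mul_path_of_ne p q h, path_mul_path_of_ne q r h', zero_mul, mul_zero]

theorem alg_mul_assoc (x y z : PathAlg k Q) : x * y * z = x * (y * z) := by
  induction x using alg_induction with
  | h0 => simp
  | hadd u v hu hv => simp only [add_mul, hu, hv]
  | hpath c p =>
    induction y using alg_induction with
    | h0 => simp
    | hadd u v hu hv => simp only [add_mul, mul_add, hu, hv]
    | hpath c' q =>
      induction z using alg_induction with
      | h0 => simp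
      | hadd u v hu hv => simp only [mul_add, hu, hv]
      | hpath c'' r => simp only [alg_smul_mul, alg_mul_smul, path_mul_assoc]

variable [Fintype V]

/-- The unit of the path algebra is the sum of the trivial paths. -/
instance : One (PathAlg k Q) := ⟨∑ i : V, idem k Q i⟩

theorem one_def : (1 : PathAlg k Q) = ∑ i : V, idem k Q i := rfl

theorem alg_one_mul (x : PathAlg k Q) : 1 * x = x := by
  induction x using alg_induction with
  | h0 => simp
  | hadd u v hu hv => simp only [mul_add, hu, hv]
  | hpath c p =>
    rw [alg_mul_smul, one_def, Finset.sum_mul, Finset.sum_eq_single p.head]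
    · congr 1
      rw [idem, path_mul_path_of_eq _ _ (by rfl)]
      congr 1
    · intro i _ hi
      exact path_mul_path_of_ne _ _ hi
    · simp

theorem alg_mul_one (x : PathAlg k Q) : x * 1 = x := by
  induction x using alg_induction with
  | h0 => simp
  | hadd u v hu hv => simp only [add_mul, hu, hv]
  | hpath c p =>
    rw [alg_smul_mul, one_def, Finset.mul_sum, Finset.sum_eq_single p.tail]
    · congr 1
      rw [idem, path_mul_path_of_eq _ _ (by rfl)]
      congr 1
      ext1 <;> simp [Path.comp, Path.triv]
    · intro i _ hi
      exact path_mul_path_of_ne _ _ (Ne.symm hi)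
    · simp

instance : Ring (PathAlg k Q) :=
  { (inferInstance : NonUnitalNonAssocRing (PathAlg k Q)) with
    mul_assoc := alg_mul_assoc
    one_mul := alg_one_mul
    mul_one := alg_mul_one }

instance : Algebra k (PathAlg k Q) := Algebra.ofModule alg_smul_mul alg_mul_smul

/-! ### Weights and the Koszul sign rule -/

/-- Which weights enter the Koszul sign rule. For homogeneous elements `u`, `v` of weights
`|u|`, `|v|` and form degrees `‖u‖`, `‖v‖`, interchanging `u` and `v` costs the sign
`(-1) ^ (|u||v| + ‖u‖‖v‖)` under `bigraded`, and `(-1) ^ (‖u‖‖v‖)` under `degreeOnly`. -/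
inductive SignRule
  | bigraded
  | degreeOnly

/-- The part of the Koszul sign that comes from two weights `m` and `n`. -/
def SignRule.sign (k : Type*) [Field k] : SignRule → ℤ → ℤ → k
  | .bigraded, m, n => (-1) ^ (m * n)
  | .degreeOnly, _, _ => 1

/-- The homogeneous component `A_n` of the path algebra. -/
def grade (k : Type*) [Field k] {V E : Type*} (Q : GradedQuiver V E) (n : ℕ) :
    Submodule k (PathAlg k Q) :=
  Submodule.span k {x | ∃ p : Path Q, p.wt = n ∧ x = path k p}

/-- The homogeneous component of weight `n` of `A ⊗ A`. -/
def grade₂ (k : Type*) [Field k] {V E : Type*} (Q : GradedQuiver V E) (n : ℤ) :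
    Submodule k (PathAlg k Q ⊗[k] PathAlg k Q) :=
  Submodule.span k
    {x | ∃ p q : Path Q, (p.wt : ℤ) + q.wt = n ∧ x = path k p ⊗ₜ[k] path k q}

/-- `sgn κ m` multiplies an element of weight `n` by the sign of the pair of weights `m`, `n`. -/
def sgn (κ : SignRule) (m : ℤ) : PathAlg k Q →ₗ[k] PathAlg k Q :=
  extend fun p => κ.sign k m p.wt • path k p

/-- The subalgebra `R` spanned by the trivial paths, as a subspace of the path algebra. -/
def R (k : Type*) [Field k] {V E : Type*} (Q : GradedQuiver V E) : Submodule k (PathAlg k Q) :=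
  Submodule.span k (Set.range (idem k Q))

/-! ### The bimodule `A ⊗_S A` and noncommutative 1-forms -/

/-- The outer bimodule structure of `A ⊗ A`: the map `u ⊗ v ↦ a u ⊗ v b`. -/
def outer (a b : PathAlg k Q) :
    PathAlg k Q ⊗[k] PathAlg k Q →ₗ[k] PathAlg k Q ⊗[k] PathAlg k Q :=
  TensorProduct.map (LinearMap.mulLeft k a) (LinearMap.mulRight k b)

/-- The relations `a s ⊗ b = a ⊗ s b` for `s ∈ S`. -/
def balanced (S : Submodule k (PathAlg k Q)) : Submodule k (PathAlg k Q ⊗[k] PathAlg k Q) :=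
  Submodule.span k {x | ∃ a b : PathAlg k Q, ∃ s ∈ S, x = (a * s) ⊗ₜ[k] b - a ⊗ₜ[k] (s * b)}

/-- The tensor product `A ⊗_S A`. -/
abbrev RelTensor (S : Submodule k (PathAlg k Q)) : Type _ :=
  (PathAlg k Q ⊗[k] PathAlg k Q) ⧸ balanced S

/-- The projection `A ⊗ A → A ⊗_S A`. -/
def cls (S : Submodule k (PathAlg k Q)) : PathAlg k Q ⊗[k] PathAlg k Q →ₗ[k] RelTensor S :=
  (balanced S).mkQ

theorem cls_surjective (S : Submodule k (PathAlg k Q)) : Function.Surjective (cls S) :=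
  Submodule.mkQ_surjective _

theorem rel_ext {S : Submodule k (PathAlg k Q)} {M : Type*} [AddCommGroup M] [Module k M]
    {f g : RelTensor S →ₗ[k] M} (h : ∀ u v, f (cls S (u ⊗ₜ v)) = g (cls S (u ⊗ₜ v))) : f = g :=
  Submodule.linearMap_qext _ (TensorProduct.ext' h)

theorem outer_tmul (a b u v : PathAlg k Q) :
    outer a b (u ⊗ₜ v) = (a * u) ⊗ₜ[k] (v * b) := rfl

theorem outer_balanced (S : Submodule k (PathAlg k Q)) (a b : PathAlg k Q) :
    balanced S ≤ (balanced S).comap (outer a b) := by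
  refine Submodule.span_le.2 ?_
  rintro _ ⟨u, v, s, hs, rfl⟩
  have e : outer a b ((u * s) ⊗ₜ[k] v - u ⊗ₜ[k] (s * v)) =
      (a * u * s) ⊗ₜ[k] (v * b) - (a * u) ⊗ₜ[k] (s * (v * b)) := by
    rw [map_sub, outer_tmul, outer_tmul, mul_assoc, mul_assoc]
  rw [SetLike.mem_coe, Submodule.mem_comap, e]
  exact Submodule.subset_span ⟨a * u, v * b, s, hs, rfl⟩

/-- The `A`-bimodule structure of `A ⊗_S A`: the map `u ⊗ v ↦ a u ⊗ v b`. -/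
def bimod (S : Submodule k (PathAlg k Q)) (a b : PathAlg k Q) : RelTensor S →ₗ[k] RelTensor S :=
  (balanced S).mapQ (balanced S) (outer a b) (outer_balanced S a b)

@[simp] theorem bimod_cls (S : Submodule k (PathAlg k Q)) (a b u v : PathAlg k Q) :
    bimod S a b (cls S (u ⊗ₜ v)) = cls S ((a * u) ⊗ₜ (v * b)) := rfl

/-- The multiplication `A ⊗_S A → A`. -/
def mulMap (S : Submodule k (PathAlg k Q)) : RelTensor S →ₗ[k] PathAlg k Q :=
  (balanced S).liftQ (LinearMap.mul' k (PathAlg k Q)) <| by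
    refine Submodule.span_le.2 ?_
    rintro _ ⟨u, v, s, hs, rfl⟩
    simp [mul_assoc]

@[simp] theorem mulMap_cls (S : Submodule k (PathAlg k Q)) (u v : PathAlg k Q) :
    mulMap S (cls S (u ⊗ₜ v)) = u * v := rfl

/-- The bimodule `Ω¹_S A` of noncommutative 1-forms: the kernel of `A ⊗_S A → A`. -/
def Om (S : Submodule k (PathAlg k Q)) : Submodule k (RelTensor S) := LinearMap.ker (mulMap S)

/-- The universal derivation `d a = 1 ⊗ a - a ⊗ 1`. -/
def d (S : Submodule k (PathAlg k Q)) (a : PathAlg k Q) : Om S :=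
  ⟨cls S (1 ⊗ₜ[k] a - a ⊗ₜ[k] 1), by
    rw [Om, LinearMap.mem_ker, map_sub, map_sub]; simp⟩

theorem mulMap_bimod (S : Submodule k (PathAlg k Q)) (a b : PathAlg k Q) (x : RelTensor S) :
    mulMap S (bimod S a b x) = a * mulMap S x * b := by
  have : mulMap S ∘ₗ bimod S a b
      = LinearMap.mulRight k b ∘ₗ LinearMap.mulLeft k a ∘ₗ mulMap S := by
    apply rel_ext
    intro u v
    simp [mul_assoc]
  exact LinearMap.congr_fun this x

/-- The `A`-bimodule structure of `Ω¹_S A`: the map `α ↦ a α b`. -/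
def Om.bimod {S : Submodule k (PathAlg k Q)} (a b : PathAlg k Q) : Om S →ₗ[k] Om S :=
  (NCQuiver.bimod S a b).restrict fun x hx => by
    have hx : mulMap S x = 0 := hx
    change mulMap S _ = 0
    rw [mulMap_bimod, hx]; simp

/-- The homogeneous component of weight `n` of `Ω¹_S A`. -/
def Om.grade (S : Submodule k (PathAlg k Q)) (n : ℤ) : Submodule k (Om S) :=
  ((grade₂ k Q n).map (cls S)).comap (Om S).subtype

theorem balanced_mono {S T : Submodule k (PathAlg k Q)} (h : S ≤ T) : balanced S ≤ balanced T := by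
  refine Submodule.span_mono ?_
  rintro _ ⟨u, v, s, hs, rfl⟩
  exact ⟨u, v, s, h hs, rfl⟩

theorem factor_cls {S T : Submodule k (PathAlg k Q)} (h : balanced S ≤ balanced T)
    (x : PathAlg k Q ⊗[k] PathAlg k Q) : Submodule.factor h (cls S x) = cls T x :=
  Submodule.factor_mk h x

/-- The canonical projection `Ω¹_S A → Ω¹_T A` for `S ⊆ T`, sending `a (d b) c` to `a (d b) c`. -/
def Om.proj {S T : Submodule k (PathAlg k Q)} (h : S ≤ T) : Om S →ₗ[k] Om T :=
  (Submodule.factor (balanced_mono h)).restrict fun x hx => by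
    have e : mulMap T ∘ₗ Submodule.factor (balanced_mono h) = mulMap S := by
      refine rel_ext fun u v => ?_
      rw [LinearMap.comp_apply, factor_cls, mulMap_cls, mulMap_cls]
    have hx : mulMap S x = 0 := hx
    have h2 : mulMap T (Submodule.factor (balanced_mono h) x) = 0 := by
      rw [← hx, ← e, LinearMap.comp_apply]
    exact LinearMap.mem_ker.2 h2

/-! ### Signs: elementary facts -/

section Signs
variable (κ : SignRule)

theorem sign_comm (m n : ℤ) : κ.sign k m n = κ.sign k n m := by
  cases κ <;> simp [SignRule.sign, mul_comm]

theorem sign_add (m n l : ℤ) : κ.sign k m (n + l) = κ.sign k m n * κ.sign k m l := by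
  cases κ <;> simp [SignRule.sign, mul_add, zpow_add₀]

theorem sign_add' (m n l : ℤ) : κ.sign k (m + n) l = κ.sign k m l * κ.sign k n l := by
  rw [sign_comm, sign_add, sign_comm, sign_comm κ l n]

theorem sign_mul_self (m n : ℤ) : κ.sign k m n * κ.sign k m n = 1 := by
  cases κ <;> simp [SignRule.sign, ← mul_zpow]

theorem sign_zero (m : ℤ) : κ.sign k m 0 = 1 := by
  cases κ <;> simp [SignRule.sign]

theorem Path.wt_comp (p q : Path Q) (h : p.tail = q.head) : (p.comp q h).wt = p.wt + q.wt := by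
  simp [Path.wt, Path.comp]

@[simp] theorem sgn_path (m : ℤ) (p : Path Q) :
    sgn κ m (path k p) = κ.sign k m p.wt • path k p := extend_path _ p

theorem sgn_idem (m : ℤ) (i : V) : sgn κ m (idem k Q i) = idem k Q i := by
  rw [idem, sgn_path]
  simp [Path.wt, Path.triv, sign_zero]

theorem sgn_one (m : ℤ) : sgn κ m (1 : PathAlg k Q) = 1 := by
  simp [one_def, sgn_idem]

theorem sgn_mul (m : ℤ) (x y : PathAlg k Q) : sgn κ m (x * y) = sgn κ m x * sgn κ m y := by
  induction x using alg_induction with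
  | h0 => simp
  | hadd u v hu hv => simp only [add_mul, map_add, hu, hv]
  | hpath c p =>
    induction y using alg_induction with
    | h0 => simp
    | hadd u v hu hv => simp only [mul_add, map_add, hu, hv]
    | hpath c' q =>
      simp only [smul_mul_assoc, mul_smul_comm, map_smul, sgn_path]
      by_cases h : p.tail = q.head
      · rw [path_mul_path_of_eq p q h, sgn_path, Path.wt_comp, Nat.cast_add, sign_add]
        simp only [smul_smul]
        congr 1
        ring
      · rw [path_mul_path_of_ne p q h]; simp

theorem sgn_R (m : ℤ) {r : PathAlg k Q} (hr : r ∈ R k Q) : sgn κ m r = r := by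
  have : R k Q ≤ LinearMap.eqLocus (sgn κ m) LinearMap.id := by
    refine Submodule.span_le.2 ?_
    rintro _ ⟨i, rfl⟩
    exact sgn_idem κ m i
  exact this hr

theorem sgn_grade (m : ℤ) {n : ℕ} {x : PathAlg k Q} (hx : x ∈ grade k Q n) :
    sgn κ m x = κ.sign k m n • x := by
  have : grade k Q n ≤ LinearMap.eqLocus (sgn κ m) (κ.sign k m n • LinearMap.id) := by
    refine Submodule.span_le.2 ?_
    rintro _ ⟨p, rfl, rfl⟩
    exact sgn_path κ m p
  exact this hx

end Signs

/-- The map `sgn` on `A ⊗_R A`. -/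
def sgnRel (κ : SignRule) (m : ℤ) : RelTensor (R k Q) →ₗ[k] RelTensor (R k Q) :=
  (balanced (R k Q)).mapQ (balanced (R k Q)) (TensorProduct.map (sgn κ m) (sgn κ m)) <| by
    refine Submodule.span_le.2 ?_
    rintro _ ⟨u, v, s, hs, rfl⟩
    refine Submodule.subset_span ⟨sgn κ m u, sgn κ m v, s, hs, ?_⟩
    simp [sgn_mul, sgn_R κ m hs]

@[simp] theorem sgnRel_cls (κ : SignRule) (m : ℤ) (u v : PathAlg k Q) :
    sgnRel κ m (cls (R k Q) (u ⊗ₜ v)) = cls (R k Q) (sgn κ m u ⊗ₜ sgn κ m v) := rfl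

/-- The map `sgn` on `Ω¹_R A`: it multiplies a 1-form of weight `n` by the sign of `m`, `n`. -/
def Om.sgn (κ : SignRule) (m : ℤ) : Om (R k Q) →ₗ[k] Om (R k Q) :=
  (sgnRel κ m).restrict fun x hx => by
    have e : mulMap (R k Q) ∘ₗ sgnRel κ m = NCQuiver.sgn κ m ∘ₗ mulMap (R k Q) := by
      apply rel_ext
      intro u v
      simp [sgn_mul]
    have hx : mulMap (R k Q) x = 0 := hx
    change mulMap (R k Q) _ = 0
    rw [← LinearMap.comp_apply, e, LinearMap.comp_apply, hx, map_zero]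

/-! ### Double derivations, contractions, Karoubi-de Rham 2-forms -/

/-- The space of `R`-linear graded double derivations `A → (A ⊗ A)_out` of weight `n`. -/
def Der (κ : SignRule) (k : Type*) [Field k] {V E : Type*} (Q : GradedQuiver V E)
    [DecidableEq V] [Fintype V] (n : ℤ) :
    Submodule k (PathAlg k Q →ₗ[k] PathAlg k Q ⊗[k] PathAlg k Q) where
  carrier := {Θ | (∀ m : ℕ, ∀ x ∈ grade k Q m, Θ x ∈ grade₂ k Q (m + n)) ∧
    (∀ x y, Θ (x * y) = outer 1 y (Θ x) + outer (sgn κ n x) 1 (Θ y)) ∧ ∀ r ∈ R k Q, Θ r = 0}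
  zero_mem' := by simp
  add_mem' := by
    rintro Θ Δ ⟨h₁, h₂, h₃⟩ ⟨h₁', h₂', h₃'⟩
    refine ⟨fun m x hx => add_mem (h₁ m x hx) (h₁' m x hx), fun x y => ?_, fun r hr => ?_⟩
    · simp only [LinearMap.add_apply, h₂, h₂', map_add]; abel
    · simp [h₃ r hr, h₃' r hr]
  smul_mem' := by
    rintro c Θ ⟨h₁, h₂, h₃⟩
    refine ⟨fun m x hx => Submodule.smul_mem _ _ (h₁ m x hx), fun x y => ?_, fun r hr => ?_⟩
    · simp only [LinearMap.smul_apply, h₂, map_smul, smul_add]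
    · simp [h₃ r hr]

/-- The graded space of double derivations, the direct sum of its components of all weights. -/
abbrev DDer (κ : SignRule) (k : Type*) [Field k] {V E : Type*} (Q : GradedQuiver V E)
    [DecidableEq V] [Fintype V] : Type _ := ⨁ n : ℤ, Der κ k Q n

theorem outer_outer (a b a' b' : PathAlg k Q) (x : PathAlg k Q ⊗[k] PathAlg k Q) :
    outer a b (outer a' b' x) = outer (a * a') (b' * b) x := by
  have : outer a b ∘ₗ outer a' b' = outer (a * a') (b' * b) :=
    TensorProduct.ext' fun u v => by simp [outer_tmul, mul_assoc]
  exact LinearMap.congr_fun this x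

theorem outer_add_left (a a' b : PathAlg k Q) : outer (a + a') b = outer a b + outer a' b :=
  TensorProduct.ext' fun u v => by simp [outer_tmul, add_mul, TensorProduct.add_tmul]

theorem outer_smul_left (c : k) (a b : PathAlg k Q) : outer (c • a) b = c • outer a b :=
  TensorProduct.ext' fun u v => by simp [outer_tmul, TensorProduct.smul_tmul']

theorem outer_one_one (x : PathAlg k Q ⊗[k] PathAlg k Q) : outer 1 1 x = x := by
  have : outer (1 : PathAlg k Q) 1 = LinearMap.id :=
    TensorProduct.ext' fun u v => by simp [outer_tmul]
  exact LinearMap.congr_fun this x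

section Contraction
variable {κ : SignRule} {n : ℤ}

/-- The map `u ⊗ v ↦ (-1)^(n|u|) u Θ(v)` on `A ⊗ A`, for `Θ` of weight `n`. -/
def contrPre (κ : SignRule) (n : ℤ) (Θ : PathAlg k Q →ₗ[k] PathAlg k Q ⊗[k] PathAlg k Q) :
    PathAlg k Q ⊗[k] PathAlg k Q →ₗ[k] PathAlg k Q ⊗[k] PathAlg k Q :=
  TensorProduct.lift (LinearMap.mk₂ k (fun u v => outer (sgn κ n u) 1 (Θ v))
    (by intros; simp [outer_add_left]) (by intros; simp [outer_smul_left])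
    (by intros; simp) (by intros; simp))

/-- The contraction `i_Θ`, with `i_Θ (a (d b) c) = (-1)^(n|a|) a Θ(b) c` for `Θ` of weight `n`. On
the kernel of the multiplication `u ⊗ v` is `u (d v)`, so it is induced by `contrPre`. -/
def contr (Θ : Der κ k Q n) : RelTensor (R k Q) →ₗ[k] PathAlg k Q ⊗[k] PathAlg k Q :=
  (balanced (R k Q)).liftQ (contrPre κ n Θ.1) <| by
    refine Submodule.span_le.2 ?_
    rintro _ ⟨u, v, s, hs, rfl⟩
    simp [contrPre, Θ.2.2.1, Θ.2.2.2 s hs, sgn_mul, sgn_R κ n hs, outer_outer]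

theorem contr_cls (Θ : Der κ k Q n) (u v : PathAlg k Q) :
    contr Θ (cls (R k Q) (u ⊗ₜ v)) = outer (sgn κ n u) 1 (Θ.1 v) := rfl

theorem contr_d (Θ : Der κ k Q n) (a : PathAlg k Q) : contr Θ (d (R k Q) a).1 = Θ.1 a := by
  have h1 : Θ.1 1 = 0 := by
    rw [one_def, map_sum]
    exact Finset.sum_eq_zero fun i _ => Θ.2.2.2 _ (Submodule.subset_span ⟨i, rfl⟩)
  simp only [d, map_sub, contr_cls, h1, sgn_one, outer_one_one, map_zero, sub_zero]

theorem contr_left (Θ : Der κ k Q n) (a : PathAlg k Q) (x : RelTensor (R k Q)) :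
    contr Θ (bimod (R k Q) a 1 x) = outer (sgn κ n a) 1 (contr Θ x) := by
  have : contr Θ ∘ₗ bimod (R k Q) a 1 = outer (sgn κ n a) 1 ∘ₗ contr Θ :=
    rel_ext fun u v => by simp [contr_cls, sgn_mul, outer_outer]
  exact LinearMap.congr_fun this x

theorem contr_right (Θ : Der κ k Q n) (a : PathAlg k Q) (x : Om (R k Q)) :
    contr Θ (bimod (R k Q) 1 a x.1) = outer 1 a (contr Θ x.1) := by
  have key : ∀ y : RelTensor (R k Q), contr Θ (bimod (R k Q) 1 a y)
      = outer 1 a (contr Θ y) + outer (sgn κ n (mulMap (R k Q) y)) 1 (Θ.1 a) := by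
    intro y
    obtain ⟨t, rfl⟩ := cls_surjective _ y
    induction t using TensorProduct.induction_on with
    | zero => simp [outer]
    | add s t hs ht => simp only [map_add, hs, ht, outer_add_left, LinearMap.add_apply]; abel
    | tmul u v =>
      simp [contr_cls, Θ.2.2.1, outer_outer, sgn_mul]
  have hx : mulMap (R k Q) x.1 = 0 := x.2
  rw [key, hx]
  simp [outer]

end Contraction

/-! ### The reduced contraction on 2-forms -/

@[simp] theorem Om.bimod_val {S : Submodule k (PathAlg k Q)} (a b : PathAlg k Q) (α : Om S) :
    (Om.bimod a b α).1 = NCQuiver.bimod S a b α.1 := rfl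

theorem bimod_bimod {S : Submodule k (PathAlg k Q)} (a b a' b' : PathAlg k Q) (x : RelTensor S) :
    bimod S a b (bimod S a' b' x) = bimod S (a * a') (b' * b) x := by
  have : bimod S a b ∘ₗ bimod S a' b' = bimod S (a * a') (b' * b) :=
    rel_ext fun u v => by simp [mul_assoc]
  exact LinearMap.congr_fun this x

theorem Om.bimod_bimod {S : Submodule k (PathAlg k Q)} (a b a' b' : PathAlg k Q) (α : Om S) :
    Om.bimod a b (Om.bimod a' b' α) = Om.bimod (a * a') (b' * b) α :=
  Subtype.ext (NCQuiver.bimod_bimod a b a' b' α.1)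

/-- For a 1-form `α`, the map `a ↦ a α`. -/
def Om.lact {S : Submodule k (PathAlg k Q)} (α : Om S) : PathAlg k Q →ₗ[k] Om S where
  toFun a := Om.bimod a 1 α
  map_add' a b := by
    have : NCQuiver.bimod S (a + b) 1 = NCQuiver.bimod S a 1 + NCQuiver.bimod S b 1 :=
      rel_ext fun u v => by simp [add_mul, TensorProduct.add_tmul]
    exact Subtype.ext (LinearMap.congr_fun this α.1)
  map_smul' c a := by
    have : NCQuiver.bimod S (c • a) 1 = c • NCQuiver.bimod S a 1 :=
      rel_ext fun u v => by simp [← TensorProduct.smul_tmul']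
    exact Subtype.ext (LinearMap.congr_fun this α.1)

/-- For a 1-form `α`, the map `a ↦ α a`. -/
def Om.ract {S : Submodule k (PathAlg k Q)} (α : Om S) : PathAlg k Q →ₗ[k] Om S where
  toFun a := Om.bimod 1 a α
  map_add' a b := by
    have : NCQuiver.bimod S 1 (a + b) = NCQuiver.bimod S 1 a + NCQuiver.bimod S 1 b :=
      rel_ext fun u v => by simp [mul_add, TensorProduct.tmul_add]
    exact Subtype.ext (LinearMap.congr_fun this α.1)
  map_smul' c a := by
    have : NCQuiver.bimod S 1 (c • a) = c • NCQuiver.bimod S 1 a :=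
      rel_ext fun u v => by simp
    exact Subtype.ext (LinearMap.congr_fun this α.1)

theorem Om.lact_add {S : Submodule k (PathAlg k Q)} (α β : Om S) :
    Om.lact (α + β) = Om.lact α + Om.lact β :=
  LinearMap.ext fun a => (Om.bimod a 1).map_add α β

theorem Om.lact_smul {S : Submodule k (PathAlg k Q)} (c : k) (α : Om S) :
    Om.lact (c • α) = c • Om.lact α :=
  LinearMap.ext fun a => (Om.bimod a 1).map_smul c α

theorem Om.ract_add {S : Submodule k (PathAlg k Q)} (α β : Om S) :
    Om.ract (α + β) = Om.ract α + Om.ract β :=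
  LinearMap.ext fun a => (Om.bimod 1 a).map_add α β

theorem Om.ract_smul {S : Submodule k (PathAlg k Q)} (c : k) (α : Om S) :
    Om.ract (c • α) = c • Om.ract α :=
  LinearMap.ext fun a => (Om.bimod 1 a).map_smul c α

section Reduced

instance : AddCommGroup (Om (R k Q) ⊗[k] Om (R k Q)) := TensorProduct.addCommGroup

variable (κ : SignRule)

/-- The map `u ⊗ γ ↦ (-1)^(|u||γ|) γ u` from `A ⊗ Ω¹` to `Ω¹`. -/
def circL : PathAlg k Q ⊗[k] Om (R k Q) →ₗ[k] Om (R k Q) :=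
  TensorProduct.lift (extend fun p => Om.bimod 1 (path k p) ∘ₗ Om.sgn κ p.wt)

/-- The map `γ ⊗ v ↦ (-1)^(|γ||v|) v γ` from `Ω¹ ⊗ A` to `Ω¹`. -/
def circR : Om (R k Q) ⊗[k] PathAlg k Q →ₗ[k] Om (R k Q) :=
  TensorProduct.lift
    (LinearMap.flip (extend fun q => Om.bimod (path k q) 1 ∘ₗ Om.sgn κ q.wt))

variable {κ} {n : ℤ}

/-- The reduced contraction `ι_Θ(α β)` of a product of two 1-forms, for `Θ` of weight `n`: it is
obtained from `i_Θ(α β) = i_Θ(α) β - (-1)^(n|α|) α i_Θ(β)`, an element of the sum of `A ⊗ Ω¹` and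
`Ω¹ ⊗ A`, by applying the map `x ⊗ y ↦ ± y x`, with the sign given by the sign rule. -/
def iotaMul (Θ : Der κ k Q n) (α β : Om (R k Q)) : Om (R k Q) :=
  circL κ (LinearMap.lTensor (PathAlg k Q) (Om.lact β) (contr Θ α.1)) -
    circR κ (LinearMap.rTensor (PathAlg k Q) (Om.ract (Om.sgn κ n α)) (contr Θ β.1))

/-- The reduced contraction `ι_Θ`, as a linear map on `Ω¹ ⊗ Ω¹`. -/
def iotaPre (Θ : Der κ k Q n) : Om (R k Q) ⊗[k] Om (R k Q) →ₗ[k] Om (R k Q) :=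
  TensorProduct.lift (LinearMap.mk₂ k (iotaMul Θ)
    (by intros; simp only [iotaMul, Submodule.coe_add, map_add, Om.ract_add,
          LinearMap.rTensor_add, LinearMap.add_apply]; abel)
    (by intros; simp only [iotaMul, Submodule.coe_smul, map_smul, Om.ract_smul,
          LinearMap.rTensor_smul, LinearMap.smul_apply, smul_sub])
    (by intros; simp only [iotaMul, Submodule.coe_add, map_add, Om.lact_add,
          LinearMap.lTensor_add, LinearMap.add_apply]; abel)
    (by intros; simp only [iotaMul, Submodule.coe_smul, map_smul, Om.lact_smul,
          LinearMap.lTensor_smul, LinearMap.smul_apply, smul_sub]))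

@[simp] theorem iotaPre_tmul (Θ : Der κ k Q n) (α β : Om (R k Q)) :
    iotaPre Θ (α ⊗ₜ β) = iotaMul Θ α β := rfl

/-- The subspace of `Ω¹ ⊗ Ω¹` by which one divides to get the Karoubi-de Rham 2-forms: it is spanned
by `α a ⊗ β - α ⊗ a β`, which gives `Ω² = Ω¹ ⊗_A Ω¹`, and by the graded commutators
`[a, α β]` and `[α, β]`, for `a ∈ A` and `α, β ∈ Ω¹` homogeneous. -/
def commRel (κ : SignRule) (k : Type*) [Field k] {V E : Type*} (Q : GradedQuiver V E)
    [DecidableEq V] [Fintype V] : Submodule k (Om (R k Q) ⊗[k] Om (R k Q)) :=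
  Submodule.span k
    ({x | ∃ (α β : Om (R k Q)) (a : PathAlg k Q),
        x = Om.bimod 1 a α ⊗ₜ[k] β - α ⊗ₜ[k] Om.bimod a 1 β} ∪
     {x | ∃ (l : ℕ) (i j : ℤ), ∃ a ∈ grade k Q l, ∃ α ∈ Om.grade (R k Q) i,
        ∃ β ∈ Om.grade (R k Q) j,
        x = Om.bimod a 1 α ⊗ₜ[k] β - κ.sign k l (i + j) • (α ⊗ₜ[k] Om.bimod 1 a β)} ∪
     {x | ∃ i j : ℤ, ∃ α ∈ Om.grade (R k Q) i, ∃ β ∈ Om.grade (R k Q) j,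
        x = α ⊗ₜ[k] β + κ.sign k i j • (β ⊗ₜ[k] α)})

/-- The space `DR² A = (Ω A / [Ω A, Ω A])²` of Karoubi-de Rham 2-forms. -/
abbrev DR2 (κ : SignRule) (k : Type*) [Field k] {V E : Type*} (Q : GradedQuiver V E)
    [DecidableEq V] [Fintype V] : Type _ :=
  (Om (R k Q) ⊗[k] Om (R k Q)) ⧸ commRel κ k Q

theorem Om.sgn_bimod (m : ℤ) (a b : PathAlg k Q) (α : Om (R k Q)) :
    Om.sgn κ m (Om.bimod a b α) =
      Om.bimod (NCQuiver.sgn κ m a) (NCQuiver.sgn κ m b) (Om.sgn κ m α) := by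
  have : sgnRel κ m ∘ₗ NCQuiver.bimod (R k Q) a b
      = NCQuiver.bimod (R k Q) (NCQuiver.sgn κ m a) (NCQuiver.sgn κ m b) ∘ₗ sgnRel κ m :=
    rel_ext fun u v => by simp [sgn_mul]
  exact Subtype.ext (LinearMap.congr_fun this α.1)

theorem Om.sgn_grade (m : ℤ) {j : ℤ} {α : Om (R k Q)} (hα : α ∈ Om.grade (R k Q) j) :
    Om.sgn κ m α = κ.sign k m j • α := by
  obtain ⟨x, hx, hxα⟩ := hα
  have hx : x ∈ grade₂ k Q j := hx
  have : grade₂ k Q j ≤ LinearMap.eqLocus (TensorProduct.map (NCQuiver.sgn κ m)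
      (NCQuiver.sgn κ m)) (κ.sign k m j • LinearMap.id) := by
    refine Submodule.span_le.2 ?_
    rintro _ ⟨p, q, rfl, rfl⟩
    simp only [SetLike.mem_coe, LinearMap.mem_eqLocus, TensorProduct.map_tmul, sgn_path,
      LinearMap.smul_apply, LinearMap.id_apply, sign_add, TensorProduct.smul_tmul_smul]
  have h2 := this hx
  refine Subtype.ext ?_
  change sgnRel κ m α.1 = κ.sign k m j • α.1
  have hxα : cls (R k Q) x = α.1 := hxα
  rw [← hxα, ← map_smul]
  exact congrArg (cls (R k Q)) h2

theorem mul_grade {l m : ℕ} {a b : PathAlg k Q} (ha : a ∈ grade k Q l) (hb : b ∈ grade k Q m) :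
    a * b ∈ grade k Q (l + m) := by
  have h := Submodule.mul_mem_mul ha hb
  rw [grade, grade, Submodule.span_mul_span] at h
  refine Submodule.span_le.2 ?_ h
  rintro _ ⟨_, ⟨p, rfl, rfl⟩, _, ⟨q, rfl, rfl⟩, rfl⟩
  dsimp only
  by_cases hpq : p.tail = q.head
  · rw [path_mul_path_of_eq p q hpq]
    exact Submodule.subset_span ⟨_, Path.wt_comp p q hpq, rfl⟩
  · rw [path_mul_path_of_ne p q hpq]
    exact zero_mem _

theorem tmul_grade {l m : ℕ} {a b : PathAlg k Q} (ha : a ∈ grade k Q l) (hb : b ∈ grade k Q m) :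
    a ⊗ₜ[k] b ∈ grade₂ k Q (l + m) := by
  have : Submodule.map₂ (TensorProduct.mk k (PathAlg k Q) (PathAlg k Q)) (grade k Q l)
      (grade k Q m) ≤ grade₂ k Q (l + m) := by
    rw [grade, grade, Submodule.map₂_span_span]
    refine Submodule.span_le.2 ?_
    rintro _ ⟨_, ⟨p, rfl, rfl⟩, _, ⟨q, rfl, rfl⟩, rfl⟩
    exact Submodule.subset_span ⟨p, q, rfl, rfl⟩
  exact this (Submodule.apply_mem_map₂ _ ha hb)

theorem path_grade (p : Path Q) : path k p ∈ grade k Q p.wt := Submodule.subset_span ⟨p, rfl, rfl⟩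

theorem one_grade : (1 : PathAlg k Q) ∈ grade k Q 0 := by
  rw [one_def]
  refine sum_mem fun i _ => ?_
  exact Submodule.subset_span ⟨Path.triv Q i, by simp [Path.wt, Path.triv], rfl⟩

theorem outer_grade₂ {l m : ℕ} {j : ℤ} {a b : PathAlg k Q} (ha : a ∈ grade k Q l)
    (hb : b ∈ grade k Q m) {x : PathAlg k Q ⊗[k] PathAlg k Q} (hx : x ∈ grade₂ k Q j) :
    outer a b x ∈ grade₂ k Q (l + j + m) := by
  have : grade₂ k Q j ≤ (grade₂ k Q (l + j + m)).comap (outer a b) := by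
    refine Submodule.span_le.2 ?_
    rintro _ ⟨p, q, rfl, rfl⟩
    have h := tmul_grade (mul_grade ha (path_grade p)) (mul_grade (path_grade q) hb)
    have e : (l : ℤ) + (p.wt + q.wt) + m = ((l + p.wt : ℕ) : ℤ) + ((q.wt + m : ℕ) : ℤ) := by
      push_cast; ring
    rw [SetLike.mem_coe, Submodule.mem_comap, outer_tmul, e]
    exact h
  exact this hx

theorem Om.bimod_grade {S : Submodule k (PathAlg k Q)} {l m : ℕ} {j : ℤ} {a b : PathAlg k Q}
    (ha : a ∈ NCQuiver.grade k Q l) (hb : b ∈ NCQuiver.grade k Q m) {α : Om S}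
    (hα : α ∈ Om.grade S j) : Om.bimod a b α ∈ Om.grade S (l + j + m) := by
  obtain ⟨x, hx, hxα⟩ := hα
  refine ⟨outer a b x, outer_grade₂ ha hb hx, ?_⟩
  have hxα : cls S x = α.1 := hxα
  change cls S (outer a b x) = NCQuiver.bimod S a b α.1
  rw [← hxα]; rfl

theorem contr_grade (Θ : Der κ k Q n) {i : ℤ} {α : Om (R k Q)} (hα : α ∈ Om.grade (R k Q) i) :
    contr Θ α.1 ∈ grade₂ k Q (i + n) := by
  obtain ⟨x, hx, hxα⟩ := hα
  have hxα : cls (R k Q) x = α.1 := hxα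
  have : grade₂ k Q i ≤ (grade₂ k Q (i + n)).comap (contr Θ ∘ₗ cls (R k Q)) := by
    refine Submodule.span_le.2 ?_
    rintro _ ⟨p, q, rfl, rfl⟩
    rw [SetLike.mem_coe, Submodule.mem_comap, LinearMap.comp_apply, contr_cls, sgn_path,
      outer_smul_left, LinearMap.smul_apply]
    refine Submodule.smul_mem _ _ ?_
    have h := outer_grade₂ (path_grade p) one_grade (Θ.2.1 _ _ (path_grade (k := k) q))
    have e : (p.wt : ℤ) + (q.wt + n) + (0 : ℕ) = p.wt + q.wt + n := by push_cast; ring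
    rwa [e] at h
  rw [← hxα]
  exact this hx

theorem iotaMul_balanced (Θ : Der κ k Q n) (α β : Om (R k Q)) (a : PathAlg k Q) :
    iotaMul Θ (Om.bimod 1 a α) β = iotaMul Θ α (Om.bimod a 1 β) := by
  have e1 : ∀ x : PathAlg k Q ⊗[k] PathAlg k Q,
      LinearMap.lTensor (PathAlg k Q) (Om.lact β) (outer 1 a x) =
        LinearMap.lTensor (PathAlg k Q) (Om.lact (Om.bimod a 1 β)) x := by
    intro x
    have : LinearMap.lTensor (PathAlg k Q) (Om.lact β) ∘ₗ outer 1 a =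
        LinearMap.lTensor (PathAlg k Q) (Om.lact (Om.bimod a 1 β)) :=
      TensorProduct.ext' fun u v => by simp [outer_tmul, Om.lact, Om.bimod_bimod]
    exact LinearMap.congr_fun this x
  have e2 : ∀ (γ : Om (R k Q)) (c : PathAlg k Q) (x : PathAlg k Q ⊗[k] PathAlg k Q),
      LinearMap.rTensor (PathAlg k Q) (Om.ract γ) (outer c 1 x) =
        LinearMap.rTensor (PathAlg k Q) (Om.ract (Om.bimod 1 c γ)) x := by
    intro γ c x
    have : LinearMap.rTensor (PathAlg k Q) (Om.ract γ) ∘ₗ outer c 1 =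
        LinearMap.rTensor (PathAlg k Q) (Om.ract (Om.bimod 1 c γ)) :=
      TensorProduct.ext' fun u v => by simp [outer_tmul, Om.ract, Om.bimod_bimod]
    exact LinearMap.congr_fun this x
  simp only [iotaMul, Om.bimod_val, contr_right, contr_left, e1, e2, Om.sgn_bimod, sgn_one]

theorem circ_comm {j m i : ℤ} (hm : m = i + n) {β : Om (R k Q)} (hβ : β ∈ Om.grade (R k Q) j)
    {x : PathAlg k Q ⊗[k] PathAlg k Q} (hx : x ∈ grade₂ k Q m) :
    circL κ (LinearMap.lTensor (PathAlg k Q) (Om.lact β) x) = κ.sign k i j •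
      circR κ (LinearMap.rTensor (PathAlg k Q) (Om.ract (Om.sgn κ n β)) x) := by
  have : grade₂ k Q m ≤ LinearMap.eqLocus
      (circL κ ∘ₗ LinearMap.lTensor (PathAlg k Q) (Om.lact β))
      (κ.sign k i j •
        (circR κ ∘ₗ LinearMap.rTensor (PathAlg k Q) (Om.ract (Om.sgn κ n β)))) := by
    refine Submodule.span_le.2 ?_
    rintro _ ⟨p, q, hpq, rfl⟩
    have hi : i = p.wt + q.wt - n := by omega
    have hs : κ.sign k i j = κ.sign k p.wt j * κ.sign k q.wt j * κ.sign k n j := by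
      have h1 : κ.sign k (i + n) j = κ.sign k (p.wt + q.wt) j := by
        congr 1; omega
      rw [sign_add', sign_add'] at h1
      rw [← h1, mul_assoc, sign_mul_self, mul_one]
    simp only [SetLike.mem_coe, LinearMap.mem_eqLocus, LinearMap.comp_apply,
      LinearMap.smul_apply, LinearMap.lTensor_tmul, LinearMap.rTensor_tmul, circL, circR,
      TensorProduct.lift.tmul, LinearMap.flip_apply, extend_path, Om.lact, Om.ract,
      LinearMap.coe_mk, AddHom.coe_mk, Om.sgn_bimod, sgn_one, sgn_path, Om.sgn_grade _ hβ,
      map_smul, smul_smul]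
    have l1 : ∀ c : k, Om.bimod (S := R k Q) (c • path k q) 1 β = c • Om.bimod (path k q) 1 β :=
      fun c => (Om.lact β).map_smul c (path k q)
    have l2 : ∀ c : k, Om.bimod (S := R k Q) 1 (c • path k p) β = c • Om.bimod 1 (path k p) β :=
      fun c => (Om.ract β).map_smul c (path k p)
    simp only [l1, l2, map_smul, smul_smul, Om.bimod_bimod, mul_one, one_mul]
    congr 1
    have h2 := sign_mul_self (k := k) κ q.wt j
    have h3 := sign_mul_self (k := k) κ n j
    rw [hs, sign_comm κ (q.wt : ℤ) (p.wt : ℤ)]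
    linear_combination (-(κ.sign k p.wt q.wt * κ.sign k p.wt j)) *
      (h2 * (κ.sign k n j * κ.sign k n j) + h3)
  exact this hx

theorem iotaMul_comm (Θ : Der κ k Q n) {i j : ℤ} {α β : Om (R k Q)}
    (hα : α ∈ Om.grade (R k Q) i) (hβ : β ∈ Om.grade (R k Q) j) :
    iotaMul Θ α β = -(κ.sign k i j • iotaMul Θ β α) := by
  rw [iotaMul, iotaMul, circ_comm rfl hβ (contr_grade Θ hα), circ_comm rfl hα (contr_grade Θ hβ),
    sign_comm κ j i, smul_sub, smul_smul, sign_mul_self, one_smul]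
  abel

theorem commRel_le_ker (Θ : Der κ k Q n) : commRel κ k Q ≤ LinearMap.ker (iotaPre Θ) := by
  refine Submodule.span_le.2 ?_
  rintro _ ((⟨α, β, a, rfl⟩ | ⟨l, i, j, a, ha, α, hα, β, hβ, rfl⟩) | ⟨i, j, α, hα, β, hβ, rfl⟩)
  · simp [iotaMul_balanced]
  · have h1 : Om.bimod a 1 α ∈ Om.grade (R k Q) (l + i) := by
      simpa using Om.bimod_grade ha one_grade hα
    have h2 : Om.bimod 1 a β ∈ Om.grade (R k Q) (j + l) := by
      simpa using Om.bimod_grade one_grade ha hβ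
    have e : iotaMul Θ (Om.bimod a 1 α) β =
        κ.sign k l (i + j) • iotaMul Θ α (Om.bimod 1 a β) := by
      rw [iotaMul_comm Θ h1 hβ, ← iotaMul_balanced, iotaMul_comm Θ h2 hα, smul_neg, neg_neg,
        smul_smul]
      congr 1
      have hc := sign_comm (k := k) κ (l : ℤ) i
      have hs := sign_mul_self (k := k) κ i j
      simp only [sign_add', sign_add, sign_comm κ j i, hc] at hs ⊢
      linear_combination (κ.sign k l j * κ.sign k i l) * hs
    simp [e]
  · simp [iotaMul_comm Θ hα hβ]

/-- The reduced contraction `ι_Θ : DR² A → Ω¹ A`. -/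
def iota (Θ : Der κ k Q n) : DR2 κ k Q →ₗ[k] Om (R k Q) :=
  (commRel κ k Q).liftQ (iotaPre Θ) (commRel_le_ker Θ)

theorem iotaPre_add (Θ Δ : Der κ k Q n) : iotaPre (Θ + Δ) = iotaPre Θ + iotaPre Δ := by
  have h : ∀ α, contr (Θ + Δ) α = contr Θ α + contr Δ α := by
    intro α
    have : contr (Θ + Δ) = contr Θ + contr Δ := rel_ext fun u v => by simp [contr_cls]
    rw [this]; rfl
  refine TensorProduct.ext' fun α β => ?_
  simp only [iotaPre_tmul, LinearMap.add_apply, iotaMul, h, map_add]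
  abel

theorem iotaPre_smul (c : k) (Θ : Der κ k Q n) : iotaPre (c • Θ) = c • iotaPre Θ := by
  have h : ∀ α, contr (c • Θ) α = c • contr Θ α := by
    intro α
    have : contr (c • Θ) = c • contr Θ := rel_ext fun u v => by simp [contr_cls]
    rw [this]; rfl
  refine TensorProduct.ext' fun α β => ?_
  simp only [iotaPre_tmul, LinearMap.smul_apply, iotaMul, h, map_smul, smul_sub]

/-- The map `ι(ω) : Θ ↦ ι_Θ ω` from double derivations to 1-forms, for `ω ∈ DR² A`. -/
def iotaForm (ω : DR2 κ k Q) : DDer κ k Q →ₗ[k] Om (R k Q) :=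
  DirectSum.toModule k ℤ _ fun n =>
    { toFun := fun Θ : Der κ k Q n => iota Θ ω
      map_add' := fun Θ Δ => by
        obtain ⟨t, rfl⟩ := Submodule.mkQ_surjective _ ω
        exact LinearMap.congr_fun (iotaPre_add Θ Δ) t
      map_smul' := fun c Θ => by
        obtain ⟨t, rfl⟩ := Submodule.mkQ_surjective _ ω
        exact LinearMap.congr_fun (iotaPre_smul c Θ) t }

end Reduced

/-- The map `f`, from double derivations to 1-forms, is a map of graded `A`-bimodules of weight `w`.
The bimodule structure on double derivations comes from the inner one on `A ⊗ A`, so that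
`(a Θ)(x) = (-1)^(|a||u|) u ⊗ a v` and `(Θ b)(x) = (-1)^(|b||x| + |b||v|) u b ⊗ v`, if
`Θ(x) = u ⊗ v`; the signs are those of the sign rule. -/
def IsGradedBimoduleMap (κ : SignRule) (w : ℤ) (f : DDer κ k Q →ₗ[k] Om (R k Q)) : Prop :=
  (∀ (n : ℤ) (Θ : Der κ k Q n),
    f (DirectSum.lof k ℤ (fun n => Der κ k Q n) n Θ) ∈ Om.grade (R k Q) (n + w)) ∧
  (∀ (n : ℤ) (l : ℕ), ∀ a ∈ grade k Q l, ∀ Θ : Der κ k Q n,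
    ∃ h : TensorProduct.map (sgn κ l) (LinearMap.mulLeft k a) ∘ₗ Θ.1 ∈ Der κ k Q (n + l),
      f (DirectSum.lof k ℤ (fun n => Der κ k Q n) (n + l) ⟨_, h⟩) =
        Om.bimod a 1 (f (DirectSum.lof k ℤ (fun n => Der κ k Q n) n Θ))) ∧
  (∀ (n : ℤ) (l : ℕ), ∀ b ∈ grade k Q l, ∀ Θ : Der κ k Q n,
    ∃ h : TensorProduct.map (LinearMap.mulRight k b) (sgn κ l) ∘ₗ Θ.1 ∘ₗ sgn κ l ∈
        Der κ k Q (n + l),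
      f (DirectSum.lof k ℤ (fun n => Der κ k Q n) (n + l) ⟨_, h⟩) =
        Om.bimod 1 b (f (DirectSum.lof k ℤ (fun n => Der κ k Q n) n Θ)))

/-! ### The algebra `B` and the bimodules `E₁` and `E₁^∨` -/

/-- The path algebra `B` of the weight 0 subquiver, as a subalgebra of `A`: it is spanned by the
paths of weight 0, that is, the paths all of whose arrows have weight 0. -/
def B (k : Type*) [Field k] {V E : Type*} (Q : GradedQuiver V E) [DecidableEq V] [Fintype V] :
    Subalgebra k (PathAlg k Q) :=
  (grade k Q 0).toSubalgebra one_grade fun x y hx hy => by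
    have h : x * y ∈ grade k Q (0 + 0) := mul_grade hx hy
    rwa [Nat.add_zero] at h

theorem idem_mem_B (i : V) : idem k Q i ∈ B k Q :=
  Submodule.subset_span ⟨Path.triv Q i, by simp [Path.wt, Path.triv], rfl⟩

theorem R_le_B : R k Q ≤ Subalgebra.toSubmodule (B k Q) := by
  refine Submodule.span_le.2 ?_
  rintro _ ⟨i, rfl⟩
  exact idem_mem_B i

/-- The idempotent `e_i` as an element of `B`. -/
def idemB (k : Type*) [Field k] {V E : Type*} (Q : GradedQuiver V E) [DecidableEq V] [Fintype V]
    (i : V) : B k Q := ⟨idem k Q i, idem_mem_B i⟩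

/-- The `B`-bimodule `E₁ = ⨁ B a B`, the sum over the arrows `a` of weight 1, inside `A`. -/
def E1 (k : Type*) [Field k] {V E : Type*} (Q : GradedQuiver V E) [DecidableEq V] [Fintype V] :
    Submodule k (PathAlg k Q) :=
  Submodule.span k {x | ∃ b ∈ B k Q, ∃ b' ∈ B k Q, ∃ a : E, Q.wt a = 1 ∧ x = b * arrow k Q a * b'}

theorem E1.mul_mem {b b' x : PathAlg k Q} (hb : b ∈ B k Q) (hb' : b' ∈ B k Q) (hx : x ∈ E1 k Q) :
    b * x * b' ∈ E1 k Q := by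
  induction hx using Submodule.span_induction with
  | mem x h =>
    obtain ⟨c, hc, c', hc', a, ha, rfl⟩ := h
    refine Submodule.subset_span ⟨b * c, (B k Q).mul_mem hb hc, c' * b',
      (B k Q).mul_mem hc' hb', a, ha, ?_⟩
    simp only [mul_assoc]
  | zero => rw [mul_zero, zero_mul]; exact zero_mem _
  | add x y _ _ h h' => rw [mul_add, add_mul]; exact add_mem h h'
  | smul c x _ h => rw [mul_smul_comm, smul_mul_assoc]; exact Submodule.smul_mem _ _ h

/-- The `B`-bimodule structure of `E₁`: the map `e ↦ b e b'`. -/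
def E1.bimod (b b' : B k Q) : E1 k Q →ₗ[k] E1 k Q where
  toFun e := ⟨b.1 * e.1 * b'.1, E1.mul_mem b.2 b'.2 e.2⟩
  map_add' e f := Subtype.ext (by simp only [Submodule.coe_add, mul_add, add_mul])
  map_smul' c e := Subtype.ext (by
    simp only [Submodule.coe_smul, mul_smul_comm, smul_mul_assoc, RingHom.id_apply])

/-- The arrows of weight 1. -/
abbrev Arrow1 {V E : Type*} (Q : GradedQuiver V E) : Type _ := {a : E // Q.wt a = 1}

/-- An arrow of weight 1 as an element of `E₁`. -/
def arr (k : Type*) [Field k] {V E : Type*} (Q : GradedQuiver V E) [DecidableEq V] [Fintype V]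
    (a : Arrow1 Q) : E1 k Q :=
  ⟨arrow k Q a.1, Submodule.subset_span
    ⟨1, one_mem _, 1, one_mem _, a.1, a.2, by rw [one_mul, mul_one]⟩⟩

/-- The dual `E₁^∨`: the maps `E₁ → B ⊗ B` of `B`-bimodules, for the outer structure on `B ⊗ B`. -/
def E1Dual (k : Type*) [Field k] {V E : Type*} (Q : GradedQuiver V E) [DecidableEq V] [Fintype V] :
    Submodule k (E1 k Q →ₗ[k] B k Q ⊗[k] B k Q) where
  carrier := {φ | ∀ (b b' : B k Q) (e : E1 k Q), φ (E1.bimod b b' e) =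
    TensorProduct.map (LinearMap.mulLeft k b) (LinearMap.mulRight k b') (φ e)}
  zero_mem' := by simp
  add_mem' := by
    intro φ ψ h h' b b' e
    simp [h b b' e, h' b b' e]
  smul_mem' := by
    intro c φ h b b' e
    simp [h b b' e]

/-- The `B`-bimodule structure of `E₁^∨`, induced by the inner one on `B ⊗ B`: if
`φ(e) = u ⊗ v`, then `(b φ b')(e) = u b' ⊗ b v`. -/
def E1Dual.bimod (b b' : B k Q) (φ : E1Dual k Q) : E1Dual k Q :=
  ⟨TensorProduct.map (LinearMap.mulRight k b') (LinearMap.mulLeft k b) ∘ₗ φ.1, by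
    intro c c' e
    have : TensorProduct.map (LinearMap.mulRight k b') (LinearMap.mulLeft k b) ∘ₗ
          TensorProduct.map (LinearMap.mulLeft k c) (LinearMap.mulRight k c') =
        TensorProduct.map (LinearMap.mulLeft k c) (LinearMap.mulRight k c') ∘ₗ
          TensorProduct.map (LinearMap.mulRight k b') (LinearMap.mulLeft k b) :=
      TensorProduct.ext' fun u v => by simp [mul_assoc]
    rw [LinearMap.comp_apply, φ.2 c c' e]
    exact LinearMap.congr_fun this (φ.1 e)⟩

/-- `φ` is the element `ã` of `E₁^∨`: it sends the arrow `a` to `e_{h(a)} ⊗ e_{t(a)}` and all other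
arrows of weight 1 to `0`. -/
def IsTilde (a : Arrow1 Q) (φ : E1Dual k Q) : Prop :=
  φ.1 (arr k Q a) = idemB k Q (Q.head a.1) ⊗ₜ[k] idemB k Q (Q.tail a.1) ∧
    ∀ b, b ≠ a → φ.1 (arr k Q b) = 0

/-- `Θ`, a double derivation of weight `-1`, is the image of `φ` under the inclusion of `E₁^∨` into
the double derivations: it extends `φ`, and it vanishes on the arrows of weight 2. (Since it
has weight `-1`, it vanishes on `B`.) -/
def IsLift {κ : SignRule} (φ : E1Dual k Q) (Θ : Der κ k Q (-1)) : Prop :=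
  (∀ e : E1 k Q, Θ.1 e.1 =
    TensorProduct.map (B k Q).val.toLinearMap (B k Q).val.toLinearMap (φ.1 e)) ∧
  ∀ a : E, Q.wt a = 2 → Θ.1 (arrow k Q a) = 0

/-- The canonical map `E₁ → Ω¹_B A`, `e ↦ d e`, which identifies `E₁` with the component
of weight 1 of `Ω¹_B A = A ⊗_B M ⊗_B A`. -/
def dB (e : E1 k Q) : Om (Subalgebra.toSubmodule (B k Q)) := d _ e.1

/-- The canonical projection from `Ω¹_R A` to `Ω¹_B A`. -/
def projB : Om (R k Q) →ₗ[k] Om (Subalgebra.toSubmodule (B k Q)) := Om.proj R_le_B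

/-! ### The canonical 2-form of a double graded quiver -/

/-- The canonical form `ω = ∑ da da*`, the sum over the arrows `a` of the original quiver. -/
def omega (κ : SignRule) (k : Type*) [Field k] {V E : Type*} [DecidableEq V] [Fintype V]
    [Fintype E] (P : GradedQuiver V E) (N : ℕ) : DR2 κ k (P.double N) :=
  ∑ a : E, (commRel κ k (P.double N)).mkQ
    (d (R k (P.double N)) (arrow k _ (Sum.inl a)) ⊗ₜ[k]
      d (R k (P.double N)) (arrow k _ (Sum.inr a)))

/-- The sign `ε(a)` of an arrow of the double quiver: it is `1` on the arrows of the original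
quiver, and on a reverse arrow `a*` it is `-1` times the weight part of the sign for interchanging
`a` and `a*`. So it is `-1` on every reverse arrow under `degreeOnly`, and
`-(-1)^(|a||a*|)` under `bigraded`. -/
def eps (κ : SignRule) (k : Type*) [Field k] {V E : Type*} (P : GradedQuiver V E) (N : ℕ) :
    E ⊕ E → k
  | Sum.inl _ => 1
  | Sum.inr a => -κ.sign k (P.wt a) ((P.double N).wt (Sum.inr a))

/-- The involution `a ↦ a*` on the arrows of weight 1 of the weight 2 double quiver. -/
def star1 {V E : Type*} (P : GradedQuiver V E) (a : Arrow1 (P.double 2)) :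
    Arrow1 (P.double 2) :=
  ⟨star a.1, by
    obtain ⟨a | a, ha⟩ := a
    · have ha : P.wt a = 1 := ha
      change 2 - P.wt a = 1
      omega
    · have ha : 2 - P.wt a = 1 := ha
      change P.wt a = 1
      omega⟩

end PathAlg
end NCQuiver
end

/-!
Both sides of `ι(ω)` are described by coordinates indexed by the arrows of the double quiver.

A double derivation of weight `n` is the same as a choice, for each arrow `a`, of an element
`Θ(a)` of `e_{h(a)} A ⊗ A e_{t(a)}` of weight `|a| + n` (`freeDer`, `der_ext`, `der_arrow`). The
bimodule of 1-forms is generated by the forms `d c` for the arrows `c` (`Om.eq_top_of_arrow`), and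
contraction with the double derivation `∂/∂c`, taken without weight signs, reads off the coefficient
of `d c` in a 1-form (`coord`).

Graded commutativity of the reduced contraction turns the two terms of `ι_Θ(da da*)` into terms of
the same shape, so that `ι(ω)(Θ) = ∑ ε(a) (± v (d a*) u)`, the sum over all arrows `a` of the double
quiver, where `Θ(a)` is written `u ⊗ v` (`iotaForm_omega`). The bimodule rules follow term by term;
for the right structure the sign that remains is that of a pair of weights `l` and
`|a| + |a*| = 2`, hence trivial. The coordinate of `ι(ω)(Θ)` at `a*` is, up to sign, `Θ(a)` with its
factors interchanged, which gives injectivity. The image is a sub-bimodule that contains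
`ι(ω)(∂/∂a) = ε(a) d a*` for every `a`, which gives surjectivity.

In weight `-1` a double derivation vanishes on `B`, so it is `B`-linear on both sides and its
restriction to `E₁` takes values in `B ⊗ B`. Hence `ã` is the restriction of `∂/∂a`, and an element of `E₁^∨` extends to
the derivation with the prescribed values on the arrows. The induced map `iotaOne` sends `φ` to
`∑ ε(a) v a* u`, where `φ(a) = u ⊗ v`. It is injective because the dual element of `a*` recovers
`φ(a)` from it, and surjective because it is a map of bimodules that hits each arrow up to sign.
-/

noncomputable section

set_option linter.unusedSectionVars false

namespace NCQuiver

section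
variable {k : Type*} [Field k] {V E : Type*} {Q : GradedQuiver V E} [DecidableEq V] [Fintype V]

/-! ### Double derivations with prescribed values on the arrows -/

theorem idem_mul_path (p : Path Q) : idem k Q p.head * path k p = path k p :=
  path_mul_path_of_eq _ _ rfl

theorem path_mul_idem (p : Path Q) : path k p * idem k Q p.tail = path k p := by
  rw [idem, path_mul_path_of_eq _ _ rfl]
  congr 1
  ext1 <;> simp [Path.comp, Path.triv]

theorem idem_mul_arrow (a : E) : idem k Q (Q.head a) * arrow k Q a = arrow k Q a :=
  idem_mul_path (Path.ofArrow Q a)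

theorem arrow_mul_idem (a : E) : arrow k Q a * idem k Q (Q.tail a) = arrow k Q a :=
  path_mul_idem (Path.ofArrow Q a)

theorem arrow_mul_path (a : E) (l : List E) (j : V) (h : IsWalk Q (Q.tail a) l j) :
    arrow k Q a * path k ⟨Q.tail a, l, j, h⟩ = path k ⟨Q.head a, a :: l, j, rfl, h⟩ :=
  path_mul_path_of_eq _ _ rfl

/-- Every path is obtained from a trivial path by multiplying with arrows from the left. -/
theorem path_induction {motive : PathAlg k Q → Prop} (h0 : ∀ i, motive (idem k Q i))
    (hmul : ∀ a x, motive x → motive (arrow k Q a * x)) (p : Path Q) : motive (path k p) := by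
  obtain ⟨i, l, j, h⟩ := p
  induction l generalizing i with
  | nil => 
    have h : i = j := h
    subst h
    exact h0 i
  | cons a l ih =>
    obtain ⟨rfl, h⟩ := h
    rw [← arrow_mul_path a l j h]
    exact hmul a _ (ih _ h)

theorem path_eq_prod_mul_idem (p : Path Q) :
    path k p = (p.arrows.map (arrow k Q)).prod * idem k Q p.tail := by
  obtain ⟨i, l, j, h⟩ := p
  induction l generalizing i with
  | nil => 
    have h : i = j := h
    subst h
    exact (one_mul _).symm
  | cons a l ih =>
    obtain ⟨rfl, h⟩ := h
    rw [← arrow_mul_path a l j h, ih _ h, List.map_cons, List.prod_cons, mul_assoc]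

theorem path_eq_idem_mul_prod (p : Path Q) :
    path k p = idem k Q p.head * (p.arrows.map (arrow k Q)).prod := by
  obtain ⟨i, l, j, h⟩ := p
  induction l generalizing i with
  | nil => 
    have h : i = j := h
    subst h
    exact (mul_one _).symm
  | cons a l ih =>
    obtain ⟨rfl, h⟩ := h
    rw [← arrow_mul_path a l j h, ih _ h, List.map_cons, List.prod_cons, ← mul_assoc, ← mul_assoc,
      arrow_mul_idem, idem_mul_arrow]

theorem idem_mem_grade (i : V) : idem k Q i ∈ grade k Q 0 := idem_mem_B i

theorem idem_mem_R (i : V) : idem k Q i ∈ R k Q := Submodule.subset_span ⟨i, rfl⟩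

theorem arrow_mem_grade (a : E) : arrow k Q a ∈ grade k Q (Q.wt a) := by
  have := path_grade (k := k) (Path.ofArrow Q a)
  simpa [Path.wt, Path.ofArrow, arrow] using this

theorem prod_mem_grade (l : List E) :
    (l.map (arrow k Q)).prod ∈ grade k Q (l.map Q.wt).sum := by
  induction l with
  | nil => exact one_grade
  | cons a l ih => simpa using mul_grade (arrow_mem_grade a) ih

theorem tensor_ext {M : Type*} [AddCommGroup M] [Module k M]
    {f g : PathAlg k Q ⊗[k] PathAlg k Q →ₗ[k] M}
    (h : ∀ p q, f (path k p ⊗ₜ path k q) = g (path k p ⊗ₜ path k q)) : f = g :=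
  TensorProduct.ext (hom_ext fun p => hom_ext fun q => h p q)

theorem outer_zero_left (b : PathAlg k Q) : outer (k := k) (Q := Q) 0 b = 0 := by
  simp [outer]

theorem outer_zero_right (a : PathAlg k Q) : outer (k := k) (Q := Q) a 0 = 0 := by
  simp [outer]

variable {κ : SignRule} {n : ℤ}

/-- The value on a product of a list of arrows of the double derivation of weight `n` with the value
`T a` on each arrow `a`, before cutting down to the head and the tail of a path. -/
def derList (κ : SignRule) (n : ℤ) (T : E → PathAlg k Q ⊗[k] PathAlg k Q) :
    List E → PathAlg k Q ⊗[k] PathAlg k Q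
  | [] => 0
  | a :: l => outer 1 (l.map (arrow k Q)).prod (T a) +
      outer (sgn κ n (arrow k Q a)) 1 (derList κ n T l)

theorem derList_append (T : E → PathAlg k Q ⊗[k] PathAlg k Q) (l l' : List E) :
    derList κ n T (l ++ l') = outer 1 (l'.map (arrow k Q)).prod (derList κ n T l) +
      outer (sgn κ n (l.map (arrow k Q)).prod) 1 (derList κ n T l') := by
  induction l with
  | nil => simp [derList, sgn_one, outer_one_one]
  | cons a l ih =>
    simp only [List.cons_append, derList, ih, map_add, outer_outer, List.map_append,
      List.prod_append, List.map_cons, List.prod_cons, sgn_mul, one_mul, mul_one, add_assoc]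

theorem derList_mem_grade₂ {T : E → PathAlg k Q ⊗[k] PathAlg k Q}
    (hT : ∀ a, T a ∈ grade₂ k Q (Q.wt a + n)) (l : List E) :
    derList κ n T l ∈ grade₂ k Q ((l.map Q.wt).sum + n) := by
  induction l with
  | nil => exact zero_mem _
  | cons a l ih =>
    rw [derList]
    refine add_mem ?_ ?_
    · have := outer_grade₂ one_grade (prod_mem_grade l) (hT a)
      convert this using 2
      push_cast [List.map_cons, List.sum_cons]; ring
    · rw [sgn_grade κ n (arrow_mem_grade a), outer_smul_left]
      refine Submodule.smul_mem _ _ ?_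
      have := outer_grade₂ (arrow_mem_grade a) one_grade ih
      convert this using 2
      push_cast [List.map_cons, List.sum_cons]; ring

theorem derPath_leibniz (T : E → PathAlg k Q ⊗[k] PathAlg k Q) (p q : Path Q) :
    extend (fun p : Path Q => outer (idem k Q p.head) (idem k Q p.tail)
        (derList κ n T p.arrows)) (path k p * path k q) =
      outer 1 (path k q) (outer (idem k Q p.head) (idem k Q p.tail) (derList κ n T p.arrows)) +
      outer (sgn κ n (path k p)) 1
        (outer (idem k Q q.head) (idem k Q q.tail) (derList κ n T q.arrows)) := by
  by_cases h : p.tail = q.head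
  · rw [path_mul_path_of_eq p q h, extend_path]
    change outer (idem k Q p.head) (idem k Q q.tail) (derList κ n T (p.arrows ++ q.arrows)) = _
    rw [derList_append, map_add]
    simp only [outer_outer, one_mul, mul_one]
    have e : idem k Q p.head * sgn κ n (p.arrows.map (arrow k Q)).prod =
        sgn κ n (path k p) * idem k Q p.tail := by
      rw [← sgn_idem κ n p.head, ← sgn_mul, ← path_eq_idem_mul_prod, ← sgn_idem κ n p.tail,
        ← sgn_mul, path_mul_idem]
    rw [← path_eq_prod_mul_idem, e, h, idem_mul_path]
  · have e1 : idem k Q p.tail * path k q = 0 := path_mul_path_of_ne _ _ h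
    have e2 : path k p * idem k Q q.head = 0 := path_mul_path_of_ne _ _ h
    rw [path_mul_path_of_ne p q h, map_zero]
    simp only [outer_outer]
    rw [e1, ← sgn_idem κ n q.head, ← sgn_mul, e2, map_zero, outer_zero_left, outer_zero_right]
    simp

/-- The double derivation of weight `n` whose value on each arrow `a` is the component
`e_{h(a)} T(a) e_{t(a)}` of the prescribed element `T(a)` of weight `|a| + n`. -/
def freeDer (κ : SignRule) (n : ℤ) (T : E → PathAlg k Q ⊗[k] PathAlg k Q)
    (hT : ∀ a, T a ∈ grade₂ k Q (Q.wt a + n)) : Der κ k Q n :=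
  ⟨extend fun p => outer (idem k Q p.head) (idem k Q p.tail) (derList κ n T p.arrows), by
    refine ⟨fun m x hx => ?_, fun x y => ?_, fun r hr => ?_⟩
    · refine (Submodule.span_le (p := (grade₂ k Q (m + n)).comap _)).2 ?_ hx
      rintro _ ⟨p, rfl, rfl⟩
      rw [SetLike.mem_coe, Submodule.mem_comap, extend_path]
      have := outer_grade₂ (idem_mem_grade p.head) (idem_mem_grade p.tail)
        (derList_mem_grade₂ (κ := κ) hT p.arrows)
      convert this using 1
      simp [Path.wt]
    · induction x using alg_induction with
      | h0 => simp [outer_zero_left]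
      | hadd u v hu hv => simp only [add_mul, map_add, hu, hv, outer_add_left,
          LinearMap.add_apply]; abel
      | hpath c p =>
        induction y using alg_induction with
        | h0 => simp [outer_zero_right]
        | hadd u v hu hv =>
          have : ∀ a b b' : PathAlg k Q, outer a (b + b') = outer a b + outer a b' :=
            fun a b b' => TensorProduct.ext' fun u v => by
              simp [outer_tmul, mul_add, TensorProduct.tmul_add]
          simp only [mul_add, map_add, hu, hv, this, LinearMap.add_apply]; abel
        | hpath c' q =>
          have : ∀ (c : k) (a b : PathAlg k Q), outer a (c • b) = c • outer a b :=
            fun c a b => TensorProduct.ext' fun u v => by simp [outer_tmul]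
          simp only [smul_mul_assoc, mul_smul_comm, map_smul, derPath_leibniz, extend_path,
            this, outer_smul_left, LinearMap.smul_apply, smul_add]
          rw [smul_comm c' c]
    · refine (Submodule.span_le (p := LinearMap.ker _)).2 ?_ hr
      rintro _ ⟨i, rfl⟩
      rw [SetLike.mem_coe, LinearMap.mem_ker, idem, extend_path]
      simp [Path.triv, derList]⟩

theorem freeDer_arrow {T : E → PathAlg k Q ⊗[k] PathAlg k Q}
    (hT : ∀ a, T a ∈ grade₂ k Q (Q.wt a + n)) (a : E) :
    (freeDer κ n T hT).1 (arrow k Q a) =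
      outer (idem k Q (Q.head a)) (idem k Q (Q.tail a)) (T a) := by
  change extend _ (path k _) = _
  rw [extend_path]
  simp [Path.ofArrow, derList, outer_one_one]

theorem der_ext {Θ Δ : Der κ k Q n} (h : ∀ a, Θ.1 (arrow k Q a) = Δ.1 (arrow k Q a)) :
    Θ = Δ := by
  refine Subtype.ext (hom_ext fun p => ?_)
  refine path_induction (motive := fun x => Θ.1 x = Δ.1 x) (fun i => ?_) (fun a x hx => ?_) p
  · rw [Θ.2.2.2 _ (idem_mem_R i), Δ.2.2.2 _ (idem_mem_R i)]
  · rw [Θ.2.2.1, Δ.2.2.1, h, hx]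

/-- The value of a double derivation on an arrow `a` lies in `e_{h(a)} A ⊗ A e_{t(a)}`. -/
theorem der_arrow (Θ : Der κ k Q n) (a : E) :
    outer (idem k Q (Q.head a)) (idem k Q (Q.tail a)) (Θ.1 (arrow k Q a)) =
      Θ.1 (arrow k Q a) := by
  conv_rhs => rw [← idem_mul_arrow, Θ.2.2.1, Θ.2.2.2 _ (idem_mem_R _), ← arrow_mul_idem,
    Θ.2.2.1, Θ.2.2.2 _ (idem_mem_R _)]
  simp [outer_outer, sgn_idem]

open Classical in
/-- The double derivation `∂/∂c`, of weight `-|c|`, that sends the arrow `c` to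
`e_{h(c)} ⊗ e_{t(c)}` and the other arrows to `0`. -/
def partialDer (κ : SignRule) (k : Type*) [Field k] (Q : GradedQuiver V E) (c : E) :
    Der κ k Q (-Q.wt c) :=
  freeDer κ _ (fun a => if a = c then 1 ⊗ₜ 1 else 0) fun a => by
    split_ifs with h
    · subst h
      simpa using tmul_grade (k := k) (Q := Q) one_grade one_grade
    · exact zero_mem _

theorem partialDer_self (c : E) : (partialDer κ k Q c).1 (arrow k Q c) =
    idem k Q (Q.head c) ⊗ₜ idem k Q (Q.tail c) := by
  rw [partialDer, freeDer_arrow, if_pos rfl, outer_tmul, mul_one, one_mul]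

theorem partialDer_of_ne {a c : E} (h : a ≠ c) : (partialDer κ k Q c).1 (arrow k Q a) = 0 := by
  rw [partialDer, freeDer_arrow, if_neg h, map_zero]

/-! ### Coordinates of 1-forms -/

theorem sgn_degreeOnly (m : ℤ) (x : PathAlg k Q) : sgn .degreeOnly m x = x := by
  have : sgn (k := k) (Q := Q) .degreeOnly m = LinearMap.id :=
    hom_ext fun p => by simp [SignRule.sign]
  rw [this]; rfl

theorem Om.bimod_eq {S : Submodule k (PathAlg k Q)} (a b : PathAlg k Q) (α : Om S) :
    Om.bimod a b α = Om.bimod a 1 (Om.bimod 1 b α) := by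
  rw [Om.bimod_bimod, mul_one, mul_one]

/-- The coordinate of a 1-form at the arrow `c`: it sends `u (d c) v` to
`u e_{h(c)} ⊗ e_{t(c)} v`, and `u (d a) v` to `0` for all other arrows `a`. It is the contraction
with `∂/∂c`, without weight signs. -/
def coord (k : Type*) [Field k] (Q : GradedQuiver V E) (c : E) :
    Om (R k Q) →ₗ[k] PathAlg k Q ⊗[k] PathAlg k Q :=
  contr (partialDer .degreeOnly k Q c) ∘ₗ (Om (R k Q)).subtype

theorem coord_bimod_d (a c : E) (u v : PathAlg k Q) :
    coord k Q c (Om.bimod u v (d _ (arrow k Q a))) =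
      outer u v ((partialDer .degreeOnly k Q c).1 (arrow k Q a)) := by
  rw [Om.bimod_eq]
  change contr _ (NCQuiver.bimod _ u 1 (Om.bimod 1 v (d _ (arrow k Q a))).1) = _
  rw [contr_left, Om.bimod_val, contr_right, contr_d, sgn_degreeOnly, outer_outer, mul_one,
    mul_one]

theorem d_mem_grade {S : Submodule k (PathAlg k Q)} {n : ℕ} {x : PathAlg k Q}
    (hx : x ∈ grade k Q n) : d S x ∈ Om.grade S n := by
  refine ⟨1 ⊗ₜ x - x ⊗ₜ 1, sub_mem ?_ ?_, rfl⟩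
  · simpa using tmul_grade one_grade hx
  · simpa using tmul_grade hx one_grade

theorem d_mul (S : Submodule k (PathAlg k Q)) (x y : PathAlg k Q) :
    d S (x * y) = Om.bimod 1 y (d S x) + Om.bimod x 1 (d S y) := by
  refine Subtype.ext ?_
  change cls S _ = bimod S 1 y (cls S _) + bimod S x 1 (cls S _)
  simp only [map_sub, bimod_cls, one_mul, mul_one]
  abel

theorem d_eq_zero {S : Submodule k (PathAlg k Q)} {s : PathAlg k Q} (hs : s ∈ S) :
    d S s = 0 := by
  refine Subtype.ext ?_
  change cls S (1 ⊗ₜ s - s ⊗ₜ 1) = 0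
  refine (Submodule.Quotient.mk_eq_zero _).2 ?_
  rw [← Submodule.neg_mem_iff, neg_sub]
  refine Submodule.subset_span ⟨1, 1, s, hs, ?_⟩
  rw [one_mul, mul_one]

/-- The derivation `d` as a linear map. -/
def dLin (S : Submodule k (PathAlg k Q)) : PathAlg k Q →ₗ[k] Om S where
  toFun := d S
  map_add' x y := Subtype.ext (by
    change cls S _ = cls S _ + cls S _
    rw [← map_add, TensorProduct.tmul_add, TensorProduct.add_tmul]
    congr 1; abel)
  map_smul' c x := Subtype.ext (by
    change cls S _ = c • cls S _
    rw [← map_smul, smul_sub, ← TensorProduct.tmul_smul, TensorProduct.smul_tmul'])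

/-- A space of 1-forms that is closed under the bimodule structure and contains `d a` for all arrows
`a` is everything. -/
theorem Om.eq_top_of_arrow {N : Submodule k (Om (R k Q))}
    (hl : ∀ p : Path Q, ∀ α ∈ N, Om.bimod (path k p) 1 α ∈ N)
    (hr : ∀ p : Path Q, ∀ α ∈ N, Om.bimod 1 (path k p) α ∈ N)
    (hd : ∀ a, d _ (arrow k Q a) ∈ N) : N = ⊤ := by
  have hl' : ∀ (x : PathAlg k Q), ∀ α ∈ N, Om.bimod x 1 α ∈ N := by
    intro x α hα
    change Om.lact α x ∈ N
    induction x using alg_induction with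
    | h0 => rw [map_zero]; exact zero_mem _
    | hadd u v hu hv => rw [map_add]; exact add_mem hu hv
    | hpath c p => rw [map_smul]; exact N.smul_mem _ (hl p α hα)
  have hr' : ∀ (x : PathAlg k Q), ∀ α ∈ N, Om.bimod 1 x α ∈ N := by
    intro x α hα
    change Om.ract α x ∈ N
    induction x using alg_induction with
    | h0 => rw [map_zero]; exact zero_mem _
    | hadd u v hu hv => rw [map_add]; exact add_mem hu hv
    | hpath c p => rw [map_smul]; exact N.smul_mem _ (hr p α hα)
  have hd' : ∀ x : PathAlg k Q, d _ x ∈ N := by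
    intro x
    change dLin _ x ∈ N
    induction x using alg_induction with
    | h0 => rw [map_zero]; exact zero_mem _
    | hadd u v hu hv => rw [map_add]; exact add_mem hu hv
    | hpath c p =>
      rw [map_smul]
      refine N.smul_mem _ (path_induction (motive := fun x => d _ x ∈ N) (fun i => ?_)
        (fun a x hx => ?_) p)
      · rw [d_eq_zero (idem_mem_R i)]; exact zero_mem _
      · rw [d_mul]; exact add_mem (hr' _ _ (hd a)) (hl' _ _ hx)
  refine eq_top_iff.2 fun α _ => ?_
  obtain ⟨t, ht⟩ := cls_surjective _ α.1
  -- On all of `A ⊗ A` the map `u ⊗ v ↦ u (d v)` is `u ⊗ v ↦ u ⊗ v - u v ⊗ 1`.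
  have key : ∀ t : PathAlg k Q ⊗[k] PathAlg k Q, ∃ β ∈ N,
      β.1 = cls (R k Q) t - cls (R k Q) (mulMap (R k Q) (cls (R k Q) t) ⊗ₜ 1) := by
    intro t
    induction t using TensorProduct.induction_on with
    | zero => exact ⟨0, zero_mem _, by simp⟩
    | add s t hs ht =>
      obtain ⟨β, hβ, e⟩ := hs
      obtain ⟨γ, hγ, f⟩ := ht
      refine ⟨β + γ, add_mem hβ hγ, ?_⟩
      rw [Submodule.coe_add, e, f]
      simp only [map_add, TensorProduct.add_tmul]
      abel
    | tmul u v =>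
      refine ⟨Om.bimod u 1 (d _ v), hl' _ _ (hd' v), ?_⟩
      change NCQuiver.bimod _ u 1 (cls _ _) = _
      simp
  obtain ⟨β, hβ, e⟩ := key t
  have h0 : mulMap (R k Q) α.1 = 0 := α.2
  rw [ht, h0, TensorProduct.zero_tmul, map_zero, sub_zero] at e
  rwa [← Subtype.ext e]
end

section
variable {k : Type*} [Field k] {V E : Type*} {Q : GradedQuiver V E} [DecidableEq V] [Fintype V]
variable {κ : SignRule} {n : ℤ}

/-! ### The reduced contraction of a product with an exact form -/

/-- The map `u ⊗ v ↦ ± v (d c) u`, with the sign for interchanging `u` and `v (d c)`. -/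
def swapD (κ : SignRule) (k : Type*) [Field k] (Q : GradedQuiver V E) (c : E) :
    PathAlg k Q ⊗[k] PathAlg k Q →ₗ[k] Om (R k Q) :=
  circL κ ∘ₗ LinearMap.lTensor (PathAlg k Q) (Om.lact (d (R k Q) (arrow k Q c)))

theorem circL_tmul {l : ℕ} {u : PathAlg k Q} (hu : u ∈ grade k Q l) (γ : Om (R k Q)) :
    circL κ (u ⊗ₜ γ) = Om.bimod 1 u (Om.sgn κ l γ) := by
  have : grade k Q l ≤ LinearMap.eqLocus (circL κ ∘ₗ (TensorProduct.mk k _ _).flip γ)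
      (Om.ract (Om.sgn κ l γ)) := by
    refine Submodule.span_le.2 ?_
    rintro _ ⟨p, rfl, rfl⟩
    simp [circL, Om.ract]
  exact this hu

theorem swapD_tmul {i j : ℕ} {u v : PathAlg k Q} (hu : u ∈ grade k Q i) (hv : v ∈ grade k Q j)
    (c : E) : swapD κ k Q c (u ⊗ₜ v) =
      κ.sign k i (j + Q.wt c) • Om.bimod v u (d _ (arrow k Q c)) := by
  change circL κ (u ⊗ₜ Om.bimod v 1 (d _ (arrow k Q c))) = _
  rw [circL_tmul hu, Om.sgn_grade (j := (j : ℤ) + Q.wt c), map_smul, Om.bimod_bimod, one_mul,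
    one_mul]
  simpa using Om.bimod_grade hv one_grade (d_mem_grade (arrow_mem_grade c))

theorem swapD_mem_grade {m : ℤ} {x : PathAlg k Q ⊗[k] PathAlg k Q} (hx : x ∈ grade₂ k Q m)
    (c : E) : swapD κ k Q c x ∈ Om.grade (R k Q) (m + Q.wt c) := by
  have : grade₂ k Q m ≤ (Om.grade (R k Q) (m + Q.wt c)).comap (swapD κ k Q c) := by
    refine Submodule.span_le.2 ?_
    rintro _ ⟨p, q, rfl, rfl⟩
    rw [SetLike.mem_coe, Submodule.mem_comap, swapD_tmul (path_grade p) (path_grade q)]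
    refine Submodule.smul_mem _ _ ?_
    have h := Om.bimod_grade (path_grade (k := k) q) (path_grade p)
      (d_mem_grade (S := R k Q) (arrow_mem_grade c))
    convert h using 2
    ring
  exact this hx

theorem swapD_left {l : ℕ} {a : PathAlg k Q} (ha : a ∈ grade k Q l) (c : E)
    (x : PathAlg k Q ⊗[k] PathAlg k Q) :
    swapD κ k Q c (TensorProduct.map (sgn κ l) (LinearMap.mulLeft k a) x) =
      Om.bimod a 1 (swapD κ k Q c x) := by
  have : swapD κ k Q c ∘ₗ TensorProduct.map (sgn κ l) (LinearMap.mulLeft k a) =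
      Om.bimod a 1 ∘ₗ swapD κ k Q c := by
    refine tensor_ext fun p q => ?_
    have h1 := sign_mul_self (k := k) κ l p.wt
    simp only [LinearMap.comp_apply, TensorProduct.map_tmul, sgn_path, LinearMap.mulLeft_apply,
      ← TensorProduct.smul_tmul', map_smul, smul_smul,
      swapD_tmul (path_grade p) (mul_grade ha (path_grade q)),
      swapD_tmul (path_grade p) (path_grade q), Om.bimod_bimod, mul_one, Nat.cast_add, sign_add,
      sign_comm κ (p.wt : ℤ) (l : ℤ)]
    congr 1
    linear_combination (κ.sign k p.wt q.wt * κ.sign k p.wt (Q.wt c)) * h1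
  exact LinearMap.congr_fun this x

theorem swapD_right {l : ℕ} {b : PathAlg k Q} (hb : b ∈ grade k Q l) (c : E)
    (x : PathAlg k Q ⊗[k] PathAlg k Q) :
    swapD κ k Q c (TensorProduct.map (LinearMap.mulRight k b) (sgn κ l) x) =
      κ.sign k l (Q.wt c) • Om.bimod 1 b (swapD κ k Q c x) := by
  have : swapD κ k Q c ∘ₗ TensorProduct.map (LinearMap.mulRight k b) (sgn κ l) =
      κ.sign k l (Q.wt c) • (Om.bimod 1 b ∘ₗ swapD κ k Q c) := by
    refine tensor_ext fun p q => ?_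
    have h1 := sign_mul_self (k := k) κ l q.wt
    simp only [LinearMap.comp_apply, LinearMap.smul_apply, TensorProduct.map_tmul, sgn_path,
      LinearMap.mulRight_apply, TensorProduct.tmul_smul, map_smul, smul_smul,
      swapD_tmul (mul_grade (path_grade p) hb) (path_grade q),
      swapD_tmul (path_grade p) (path_grade q), Om.bimod_bimod, one_mul, Nat.cast_add, sign_add,
      sign_add']
    congr 1
    linear_combination (κ.sign k p.wt q.wt * κ.sign k p.wt (Q.wt c) * κ.sign k l (Q.wt c)) * h1
  exact LinearMap.congr_fun this x

theorem iotaMul_d_d (Θ : Der κ k Q n) (a b : E) :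
    iotaMul Θ (d _ (arrow k Q a)) (d _ (arrow k Q b)) =
      swapD κ k Q b (Θ.1 (arrow k Q a)) -
        κ.sign k (Q.wt a) (Q.wt b) • swapD κ k Q a (Θ.1 (arrow k Q b)) := by
  have h := circ_comm (κ := κ) (n := n) (i := Q.wt b) rfl
    (d_mem_grade (S := R k Q) (arrow_mem_grade (k := k) a))
    (Θ.2.1 _ _ (arrow_mem_grade (k := k) b))
  rw [iotaMul, contr_d, contr_d, swapD, swapD, LinearMap.comp_apply, LinearMap.comp_apply, h,
    smul_smul, sign_comm κ (Q.wt a : ℤ), sign_mul_self, one_smul]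

/-! ### Recovering a double derivation from its contraction -/

/-- The map `u ⊗ v ↦ ± v ⊗ u`, with the sign of the pair of weights `|u|`, `|v| + w`. It describes
`swapD` in coordinates, where `w` is the weight of the arrow. -/
def swapSgn (κ : SignRule) (k : Type*) [Field k] (Q : GradedQuiver V E) (w : ℤ) :
    PathAlg k Q ⊗[k] PathAlg k Q →ₗ[k] PathAlg k Q ⊗[k] PathAlg k Q :=
  TensorProduct.lift (extend fun p => extend fun q =>
    κ.sign k p.wt (q.wt + w) • (path k q ⊗ₜ path k p))

theorem swapSgn_path (w : ℤ) (p q : Path Q) : swapSgn κ k Q w (path k p ⊗ₜ path k q) =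
    κ.sign k p.wt (q.wt + w) • (path k q ⊗ₜ path k p) := by
  simp [swapSgn]

theorem swapSgn_injective (w : ℤ) : Function.Injective (swapSgn κ k Q w) := by
  have : (TensorProduct.lift (extend fun q => extend fun p =>
      κ.sign k p.wt (q.wt + w) • (path k p ⊗ₜ[k] path k q))) ∘ₗ swapSgn κ k Q w =
        LinearMap.id :=
    tensor_ext fun p q => by simp [swapSgn_path, smul_smul, sign_mul_self]
  exact Function.LeftInverse.injective (LinearMap.congr_fun this)

theorem coord_swapD_self (c : E) (x : PathAlg k Q ⊗[k] PathAlg k Q) :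
    coord k Q c (swapD κ k Q c x) = swapSgn κ k Q (Q.wt c)
      (outer (idem k Q (Q.tail c)) (idem k Q (Q.head c)) x) := by
  have : coord k Q c ∘ₗ swapD κ k Q c = swapSgn κ k Q (Q.wt c) ∘ₗ
      outer (idem k Q (Q.tail c)) (idem k Q (Q.head c)) := by
    refine tensor_ext fun p q => ?_
    rw [LinearMap.comp_apply, swapD_tmul (path_grade p) (path_grade q), map_smul, coord_bimod_d,
      partialDer_self, LinearMap.comp_apply, outer_tmul, outer_tmul]
    by_cases hp : Q.tail c = p.head
    · by_cases hq : q.tail = Q.head c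
      · rw [hp, idem_mul_path, ← hq, path_mul_idem, swapSgn_path]
      · have : path k q * idem k Q (Q.head c) = 0 := path_mul_path_of_ne _ _ hq
        simp [this]
    · have : idem k Q (Q.tail c) * path k p = 0 := path_mul_path_of_ne _ _ hp
      simp [this]
  exact LinearMap.congr_fun this x

theorem coord_swapD_of_ne {a c : E} (h : a ≠ c) (x : PathAlg k Q ⊗[k] PathAlg k Q) :
    coord k Q c (swapD κ k Q a x) = 0 := by
  have : coord k Q c ∘ₗ swapD κ k Q a = 0 := tensor_ext fun p q => by
    rw [LinearMap.comp_apply, swapD_tmul (path_grade p) (path_grade q), map_smul, coord_bimod_d,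
      partialDer_of_ne h, map_zero, smul_zero, LinearMap.zero_apply]
  exact LinearMap.congr_fun this x

/-- The projection of `A ⊗ A` onto its component of weight `m`. -/
def proj₂ (k : Type*) [Field k] (Q : GradedQuiver V E) (m : ℤ) :
    PathAlg k Q ⊗[k] PathAlg k Q →ₗ[k] PathAlg k Q ⊗[k] PathAlg k Q :=
  TensorProduct.lift (extend fun p => extend fun q =>
    if (p.wt : ℤ) + q.wt = m then path k p ⊗ₜ path k q else 0)

theorem proj₂_apply {i m : ℤ} {x : PathAlg k Q ⊗[k] PathAlg k Q} (hx : x ∈ grade₂ k Q i) :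
    proj₂ k Q m x = if i = m then x else 0 := by
  have : grade₂ k Q i ≤ LinearMap.eqLocus (proj₂ k Q m)
      (if i = m then LinearMap.id else 0) := by
    refine Submodule.span_le.2 ?_
    rintro _ ⟨p, q, rfl, rfl⟩
    rw [SetLike.mem_coe, LinearMap.mem_eqLocus]
    split_ifs with h <;> simp [proj₂, h]
  have h := this hx
  rw [LinearMap.mem_eqLocus] at h
  rw [h]
  split_ifs <;> rfl

/-! ### The bimodule structure on double derivations -/

theorem sgn_sgn (m n : ℤ) (x : PathAlg k Q) : sgn κ m (sgn κ n x) = sgn κ (n + m) x := by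
  have : sgn (k := k) (Q := Q) κ m ∘ₗ sgn κ n = sgn κ (n + m) :=
    hom_ext fun p => by simp [smul_smul, sign_add']
  exact LinearMap.congr_fun this x

theorem sgn_sgn_self (m : ℤ) (x : PathAlg k Q) : sgn κ m (sgn κ m x) = x := by
  have : sgn (k := k) (Q := Q) κ m ∘ₗ sgn κ m = LinearMap.id :=
    hom_ext fun p => by simp [smul_smul, sign_mul_self]
  exact LinearMap.congr_fun this x

theorem lmul_mem_der {l : ℕ} {a : PathAlg k Q} (ha : a ∈ grade k Q l) (Θ : Der κ k Q n) :
    TensorProduct.map (sgn κ l) (LinearMap.mulLeft k a) ∘ₗ Θ.1 ∈ Der κ k Q (n + l) := by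
  have key : ∀ (u v : PathAlg k Q) (x : PathAlg k Q ⊗[k] PathAlg k Q),
      TensorProduct.map (sgn κ l) (LinearMap.mulLeft k a) (outer u v x) =
        outer (sgn κ l u) v (TensorProduct.map (sgn κ l) (LinearMap.mulLeft k a) x) :=
    fun u v => LinearMap.congr_fun
      (f := TensorProduct.map (sgn κ l) (LinearMap.mulLeft k a) ∘ₗ outer u v)
      (g := outer (sgn κ l u) v ∘ₗ TensorProduct.map (sgn κ l) (LinearMap.mulLeft k a))
      (TensorProduct.ext' fun x y => by simp [outer_tmul, sgn_mul, mul_assoc])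
  refine ⟨fun m x hx => ?_, fun x y => ?_, fun r hr => ?_⟩
  · refine (Submodule.span_le (p := (grade₂ k Q (m + (n + l))).comap
      (TensorProduct.map (sgn κ l) (LinearMap.mulLeft k a)))).2 ?_ (Θ.2.1 m x hx)
    rintro _ ⟨p, q, hpq, rfl⟩
    rw [SetLike.mem_coe, Submodule.mem_comap, TensorProduct.map_tmul, sgn_path,
      ← TensorProduct.smul_tmul']
    refine Submodule.smul_mem _ _ ?_
    have h := tmul_grade (path_grade p) (mul_grade ha (path_grade q))
    rwa [show (p.wt : ℤ) + (l + q.wt : ℕ) = m + (n + l) by push_cast; omega] at h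
  · simp only [LinearMap.comp_apply, Θ.2.2.1, map_add, key, sgn_one, sgn_sgn]
  · rw [LinearMap.comp_apply, Θ.2.2.2 r hr, map_zero]

theorem rmul_mem_der {l : ℕ} {b : PathAlg k Q} (hb : b ∈ grade k Q l) (Θ : Der κ k Q n) :
    TensorProduct.map (LinearMap.mulRight k b) (sgn κ l) ∘ₗ Θ.1 ∘ₗ sgn κ l ∈
      Der κ k Q (n + l) := by
  have key : ∀ (u v : PathAlg k Q) (x : PathAlg k Q ⊗[k] PathAlg k Q),
      TensorProduct.map (LinearMap.mulRight k b) (sgn κ l) (outer u v x) =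
        outer u (sgn κ l v) (TensorProduct.map (LinearMap.mulRight k b) (sgn κ l) x) :=
    fun u v => LinearMap.congr_fun
      (f := TensorProduct.map (LinearMap.mulRight k b) (sgn κ l) ∘ₗ outer u v)
      (g := outer u (sgn κ l v) ∘ₗ TensorProduct.map (LinearMap.mulRight k b) (sgn κ l))
      (TensorProduct.ext' fun x y => by simp [outer_tmul, sgn_mul, mul_assoc])
  refine ⟨fun m x hx => ?_, fun x y => ?_, fun r hr => ?_⟩
  · rw [LinearMap.comp_apply, LinearMap.comp_apply, sgn_grade κ l hx, map_smul, map_smul]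
    refine Submodule.smul_mem _ _ ((Submodule.span_le (p := (grade₂ k Q (m + (n + l))).comap
      (TensorProduct.map (LinearMap.mulRight k b) (sgn κ l)))).2 ?_ (Θ.2.1 m x hx))
    rintro _ ⟨p, q, hpq, rfl⟩
    rw [SetLike.mem_coe, Submodule.mem_comap, TensorProduct.map_tmul, sgn_path,
      TensorProduct.tmul_smul]
    refine Submodule.smul_mem _ _ ?_
    have h := tmul_grade (mul_grade (path_grade p) hb) (path_grade q)
    rwa [show ((p.wt + l : ℕ) : ℤ) + q.wt = m + (n + l) by push_cast; omega] at h
  · simp only [LinearMap.comp_apply, sgn_mul, Θ.2.2.1, map_add, key, sgn_one, sgn_sgn_self]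
    rw [sgn_sgn, add_comm (l : ℤ)]
  · rw [LinearMap.comp_apply, LinearMap.comp_apply, sgn_R κ l hr, Θ.2.2.2 r hr, map_zero]
end

section
variable {k : Type*} [Field k] {V E : Type*} [DecidableEq V] [Fintype V] [Fintype E]
  {P : GradedQuiver V E} {N : ℕ} {κ : SignRule} {n : ℤ}

/-! ### The contraction of the canonical 2-form -/

theorem GradedQuiver.double_head_star (a : E ⊕ E) :
    (P.double N).head (star a) = (P.double N).tail a := by
  cases a <;> rfl

theorem GradedQuiver.double_tail_star (a : E ⊕ E) :
    (P.double N).tail (star a) = (P.double N).head a := by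
  cases a <;> rfl

theorem star_star (a : E ⊕ E) : star (star a) = a := Sum.swap_swap a

theorem GradedQuiver.double_wt_add_wt_star (hP : ∀ a, P.wt a ≤ N) (a : E ⊕ E) :
    (P.double N).wt a + (P.double N).wt (star a) = N := by
  cases a with
  | inl a => exact Nat.add_sub_of_le (hP a)
  | inr a => exact Nat.sub_add_cancel (hP a)

theorem eps_mul_self (a : E ⊕ E) : eps κ k P N a * eps κ k P N a = 1 := by
  cases a <;> simp [eps, sign_mul_self]

theorem eps_smul_injective {M : Type*} [AddCommGroup M] [Module k M] (a : E ⊕ E) :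
    Function.Injective fun x : M => eps κ k P N a • x :=
  Function.LeftInverse.injective (g := fun x : M => eps κ k P N a • x) fun x => by
    dsimp only
    rw [smul_smul, eps_mul_self, one_smul]

/-- The contraction of `ω` by `Θ` is the sum over all arrows `a` of the double quiver of
`± ε(a) v (d a*) u`, where `Θ(a) = u ⊗ v`. The term of a reverse arrow comes from the second half
of the Leibniz rule, brought into this shape by graded commutativity at the cost of the sign
contained in `ε`. -/
theorem iotaForm_omega (Θ : Der κ k (P.double N) n) :
    iotaForm (omega κ k P N) (DirectSum.lof k ℤ (fun n => Der κ k (P.double N) n) n Θ) =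
      ∑ a : E ⊕ E, eps κ k P N a •
        swapD κ k (P.double N) (star a) (Θ.1 (arrow k (P.double N) a)) := by
  rw [iotaForm, DirectSum.toModule_lof]
  change iota Θ (omega κ k P N) = _
  rw [omega, map_sum, Fintype.sum_sum_type, ← Finset.sum_add_distrib]
  refine Finset.sum_congr rfl fun a _ => ?_
  change iotaMul Θ _ _ = _
  rw [iotaMul_d_d, eps, eps, one_smul, sub_eq_add_neg]
  exact congrArg _ (neg_smul _ _).symm

theorem iotaForm_omega_mem_grade (hP : ∀ a, P.wt a ≤ N) (Θ : Der κ k (P.double N) n) :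
    iotaForm (omega κ k P N) (DirectSum.lof k ℤ (fun n => Der κ k (P.double N) n) n Θ) ∈
      Om.grade _ (n + N) := by
  rw [iotaForm_omega]
  refine sum_mem fun a _ => Submodule.smul_mem _ _ ?_
  have h := swapD_mem_grade (κ := κ) (Θ.2.1 _ _ (arrow_mem_grade a)) (star a)
  convert h using 2
  have := GradedQuiver.double_wt_add_wt_star hP a
  omega

theorem coord_iotaForm_omega (Θ : Der κ k (P.double N) n) (a : E ⊕ E) :
    coord k _ (star a) (iotaForm (omega κ k P N)
      (DirectSum.lof k ℤ (fun n => Der κ k (P.double N) n) n Θ)) =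
    eps κ k P N a • swapSgn κ k _ ((P.double N).wt (star a))
      (Θ.1 (arrow k (P.double N) a)) := by
  rw [iotaForm_omega, map_sum, Finset.sum_eq_single a]
  · rw [map_smul, coord_swapD_self, GradedQuiver.double_tail_star,
      GradedQuiver.double_head_star, der_arrow]
  · intro b _ hb
    rw [map_smul, coord_swapD_of_ne, smul_zero]
    exact fun h => hb (by rw [← star_star b, h, star_star])
  · simp

theorem iotaForm_omega_injective (hP : ∀ a, P.wt a ≤ N) :
    Function.Injective (iotaForm (omega κ k P N)) := by
  intro Θ Δ hΘ
  refine DirectSum.ext_component k fun n => ?_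
  refine der_ext fun a => ?_
  -- The component of weight `n + |a| = n + N - |a*|` of the coordinate at `a*` only sees the
  -- component of weight `n` of `Θ`.
  have key : proj₂ k _ (n + N - (P.double N).wt (star a)) ∘ₗ coord k _ (star a) ∘ₗ
        iotaForm (omega κ k P N) =
      coord k _ (star a) ∘ₗ iotaForm (omega κ k P N) ∘ₗ
        DirectSum.lof k ℤ (fun n => Der κ k (P.double N) n) n ∘ₗ
          DirectSum.component k ℤ (fun n => Der κ k (P.double N) n) n := by
    refine DirectSum.linearMap_ext k fun m => LinearMap.ext fun Δ => ?_
    have hg : coord k _ (star a) (iotaForm (omega κ k P N)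
        (DirectSum.lof k ℤ (fun n => Der κ k (P.double N) n) m Δ)) ∈
          grade₂ k (P.double N) (m + N - (P.double N).wt (star a)) :=
      contr_grade _ (iotaForm_omega_mem_grade hP Δ)
    simp only [LinearMap.comp_apply]
    rw [proj₂_apply hg]
    split_ifs with h
    · obtain rfl : m = n := by omega
      rw [DirectSum.component.lof_self]
    · rw [DirectSum.component.of, dif_neg (fun e => h (by rw [e])), map_zero, map_zero, map_zero]
  have h := LinearMap.congr_fun key Θ
  have h₂ := LinearMap.congr_fun key Δ
  simp only [LinearMap.comp_apply, hΘ, coord_iotaForm_omega] at h h₂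
  rw [h₂] at h
  exact swapSgn_injective _ (eps_smul_injective a h.symm)

/-- The double derivation `∂/∂a`, given by its values on the arrows, contracts `ω` to
`ε(a) d a*`. -/
theorem iotaForm_omega_of_eq_single {a : E ⊕ E} {Θ : Der κ k (P.double N) n}
    (h : Θ.1 (arrow k _ a) =
      idem k _ ((P.double N).head a) ⊗ₜ idem k _ ((P.double N).tail a))
    (h' : ∀ b, b ≠ a → Θ.1 (arrow k _ b) = 0) :
    iotaForm (omega κ k P N) (DirectSum.lof k ℤ (fun n => Der κ k (P.double N) n) n Θ) =
      eps κ k P N a • d _ (arrow k (P.double N) (star a)) := by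
  rw [iotaForm_omega, Finset.sum_eq_single a]
  · rw [h, swapD_tmul (idem_mem_grade _) (idem_mem_grade _), sign_comm, Nat.cast_zero, sign_zero,
      one_smul]
    congr 1
    rw [← GradedQuiver.double_tail_star, ← GradedQuiver.double_head_star]
    conv_rhs => rw [← idem_mul_arrow, d_mul, d_eq_zero (idem_mem_R _), map_zero, zero_add,
      ← arrow_mul_idem, d_mul, d_eq_zero (idem_mem_R _), map_zero, add_zero, Om.bimod_bimod,
      mul_one, mul_one]
  · intro b _ hb
    rw [h' b hb, map_zero, smul_zero]
  · simp

/-- The parity of the total weight `2` makes `ι(ω)` a map of right modules without signs. -/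
theorem sign_two (l : ℤ) : κ.sign k l 2 = 1 := by
  rw [show (2 : ℤ) = 1 + 1 from rfl, sign_add, sign_mul_self]

theorem iotaForm_omega_isGradedBimoduleMap (hP : ∀ a, P.wt a ≤ 2) :
    IsGradedBimoduleMap κ 2 (iotaForm (omega κ k P 2)) := by
  refine ⟨fun n Θ => iotaForm_omega_mem_grade hP Θ, fun n l a ha Θ => ⟨lmul_mem_der ha Θ, ?_⟩,
    fun n l b hb Θ => ⟨rmul_mem_der hb Θ, ?_⟩⟩
  · rw [iotaForm_omega, iotaForm_omega, map_sum]
    refine Finset.sum_congr rfl fun c _ => ?_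
    rw [LinearMap.comp_apply, swapD_left ha, map_smul]
  · rw [iotaForm_omega, iotaForm_omega, map_sum]
    refine Finset.sum_congr rfl fun c _ => ?_
    have e : ((P.double 2).wt c : ℤ) + (P.double 2).wt (star c) = 2 := by
      exact_mod_cast GradedQuiver.double_wt_add_wt_star hP c
    rw [LinearMap.comp_apply, LinearMap.comp_apply, sgn_grade κ l (arrow_mem_grade c), map_smul,
      map_smul, map_smul, swapD_right hb, map_smul, smul_smul (κ.sign k _ _), ← sign_add, e,
      sign_two, one_smul]

theorem iotaForm_omega_surjective (hP : ∀ a, P.wt a ≤ 2) :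
    Function.Surjective (iotaForm (omega κ k P 2)) := by
  obtain ⟨-, hl, hr⟩ := iotaForm_omega_isGradedBimoduleMap (k := k) (κ := κ) hP
  rw [← LinearMap.range_eq_top]
  refine Om.eq_top_of_arrow ?_ ?_ fun a => ?_
  · rintro p _ ⟨Θ, rfl⟩
    induction Θ using DirectSum.induction_on with
    | zero => simp
    | add Θ Δ h h' => rw [map_add, map_add]; exact add_mem h h'
    | of n Θ =>
      obtain ⟨h, e⟩ := hl n _ _ (path_grade p) Θ
      exact ⟨_, e⟩
  · rintro p _ ⟨Θ, rfl⟩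
    induction Θ using DirectSum.induction_on with
    | zero => simp
    | add Θ Δ h h' => rw [map_add, map_add]; exact add_mem h h'
    | of n Θ =>
      obtain ⟨h, e⟩ := hr n _ _ (path_grade p) Θ
      exact ⟨_, e⟩
  · have h := iotaForm_omega_of_eq_single (P := P) (N := 2) (κ := κ) (k := k)
      (partialDer_self (star a)) fun b hb => partialDer_of_ne hb
    rw [star_star] at h
    refine ⟨eps κ k P 2 (star a) • DirectSum.lof k ℤ (fun n => Der κ k (P.double 2) n) _
      (partialDer κ k _ (star a)), ?_⟩
    rw [map_smul, h, smul_smul, eps_mul_self, one_smul]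
end

section
variable {k : Type*} [Field k] {V E : Type*} {Q : GradedQuiver V E} [DecidableEq V] [Fintype V]
variable {κ : SignRule}

/-! ### The bimodule `E₁` and its dual -/

theorem E1.span_bimod_arr :
    Submodule.span k {e | ∃ (b b' : B k Q) (a : Arrow1 Q), e = E1.bimod b b' (arr k Q a)} = ⊤ := by
  refine eq_top_iff.2 fun ⟨e, he⟩ h => ?_
  clear h
  induction he using Submodule.span_induction with
  | mem x h =>
    obtain ⟨b, hb, b', hb', a, ha, rfl⟩ := h
    exact Submodule.subset_span ⟨⟨b, hb⟩, ⟨b', hb'⟩, ⟨a, ha⟩, rfl⟩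
  | zero => exact zero_mem _
  | add x y hx hy h h' => exact add_mem h h'
  | smul c x hx h => exact Submodule.smul_mem _ c h

theorem E1.linearMap_ext {M : Type*} [AddCommGroup M] [Module k M] {f g : E1 k Q →ₗ[k] M}
    (h : ∀ (b b' : B k Q) (a : Arrow1 Q),
      f (E1.bimod b b' (arr k Q a)) = g (E1.bimod b b' (arr k Q a))) : f = g := by
  refine LinearMap.ext_on E1.span_bimod_arr ?_
  rintro _ ⟨b, b', a, rfl⟩
  exact h b b' a

theorem E1Dual.ext_arr {φ ψ : E1Dual k Q} (h : ∀ a, φ.1 (arr k Q a) = ψ.1 (arr k Q a)) :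
    φ = ψ :=
  Subtype.ext (E1.linearMap_ext fun b b' a => by rw [φ.2, ψ.2, h])

theorem E1_le_grade : E1 k Q ≤ grade k Q 1 := by
  refine Submodule.span_le.2 ?_
  rintro _ ⟨b, hb, b', hb', a, ha, rfl⟩
  have := mul_grade (mul_grade (l := 0) hb (arrow_mem_grade a)) (m := 0) hb'
  rwa [ha] at this

theorem E1.bimod_idem (a : Arrow1 Q) :
    E1.bimod (idemB k Q (Q.head a.1)) (idemB k Q (Q.tail a.1)) (arr k Q a) = arr k Q a := by
  refine Subtype.ext ?_
  change idem k Q _ * arrow k Q a.1 * idem k Q _ = arrow k Q a.1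
  rw [idem_mul_arrow, arrow_mul_idem]

/-- The inclusion of `B ⊗ B` in `A ⊗ A`. -/
def incl₂ (k : Type*) [Field k] (Q : GradedQuiver V E) :
    B k Q ⊗[k] B k Q →ₗ[k] PathAlg k Q ⊗[k] PathAlg k Q :=
  TensorProduct.map (B k Q).val.toLinearMap (B k Q).val.toLinearMap

theorem incl₂_tmul (u v : B k Q) : incl₂ k Q (u ⊗ₜ v) = u.1 ⊗ₜ v.1 := rfl

/-- The projection of `A` onto its component `B` of weight `0`. -/
def projWtZero (k : Type*) [Field k] (Q : GradedQuiver V E) : PathAlg k Q →ₗ[k] B k Q :=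
  extend fun p => if h : p.wt = 0 then ⟨path k p, Submodule.subset_span ⟨p, h, rfl⟩⟩ else 0

theorem projWtZero_coe (b : B k Q) : projWtZero k Q b.1 = b := by
  refine Subtype.ext ?_
  have : grade k Q 0 ≤ LinearMap.eqLocus ((B k Q).val.toLinearMap ∘ₗ projWtZero k Q)
      LinearMap.id := by
    refine Submodule.span_le.2 ?_
    rintro _ ⟨p, hp, rfl⟩
    simp [projWtZero, hp]
  exact this b.2

theorem incl₂_left_inv (x : B k Q ⊗[k] B k Q) :
    TensorProduct.map (projWtZero k Q) (projWtZero k Q) (incl₂ k Q x) = x := by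
  have : TensorProduct.map (projWtZero k Q) (projWtZero k Q) ∘ₗ incl₂ k Q = LinearMap.id :=
    TensorProduct.ext' fun u v => by simp [incl₂_tmul, projWtZero_coe]
  exact LinearMap.congr_fun this x

theorem incl₂_injective : Function.Injective (incl₂ k Q) :=
  Function.LeftInverse.injective incl₂_left_inv

theorem incl₂_right_inv {x : PathAlg k Q ⊗[k] PathAlg k Q} (hx : x ∈ grade₂ k Q 0) :
    incl₂ k Q (TensorProduct.map (projWtZero k Q) (projWtZero k Q) x) = x := by
  have : grade₂ k Q 0 ≤ LinearMap.eqLocus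
      (incl₂ k Q ∘ₗ TensorProduct.map (projWtZero k Q) (projWtZero k Q)) LinearMap.id := by
    refine Submodule.span_le.2 ?_
    rintro _ ⟨p, q, hpq, rfl⟩
    have hp : p.wt = 0 := by omega
    have hq : q.wt = 0 := by omega
    simp [projWtZero, hp, hq, incl₂_tmul]
  exact this hx

theorem incl₂_mem_grade₂ (x : B k Q ⊗[k] B k Q) : incl₂ k Q x ∈ grade₂ k Q 0 := by
  induction x using TensorProduct.induction_on with
  | zero => rw [map_zero]; exact zero_mem _
  | add x y hx hy => rw [map_add]; exact add_mem hx hy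
  | tmul u v => exact tmul_grade (l := 0) (m := 0) u.2 v.2

theorem incl₂_outer (b b' : B k Q) (x : B k Q ⊗[k] B k Q) :
    incl₂ k Q (TensorProduct.map (LinearMap.mulLeft k b) (LinearMap.mulRight k b') x) =
      outer b.1 b'.1 (incl₂ k Q x) := by
  have : incl₂ k Q ∘ₗ TensorProduct.map (LinearMap.mulLeft k b) (LinearMap.mulRight k b') =
      outer b.1 b'.1 ∘ₗ incl₂ k Q := TensorProduct.ext' fun u v => rfl
  exact LinearMap.congr_fun this x

theorem grade₂_eq_bot {m : ℤ} (hm : m < 0) : grade₂ k Q m = ⊥ := by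
  refine eq_bot_iff.2 (Submodule.span_le.2 ?_)
  rintro _ ⟨p, q, h, rfl⟩
  omega

theorem der_neg_one_B (Θ : Der κ k Q (-1)) {b : PathAlg k Q} (hb : b ∈ B k Q) : Θ.1 b = 0 := by
  have := Θ.2.1 0 b hb
  rwa [grade₂_eq_bot (by simp), Submodule.mem_bot] at this

/-- A double derivation of weight `-1` is `B`-linear for the outer structure. -/
theorem der_neg_one_bimod (Θ : Der κ k Q (-1)) {b b' : PathAlg k Q} (hb : b ∈ B k Q)
    (hb' : b' ∈ B k Q) (x : PathAlg k Q) : Θ.1 (b * x * b') = outer b b' (Θ.1 x) := by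
  have hs : sgn κ (-1) b = b := by
    rw [sgn_grade κ (-1) (n := 0) hb, Nat.cast_zero, sign_zero, one_smul]
  rw [Θ.2.2.1, Θ.2.2.1, der_neg_one_B Θ hb, der_neg_one_B Θ hb', hs, map_zero, map_zero,
    zero_add, add_zero, outer_outer, one_mul, one_mul]

/-- The restriction of a double derivation of weight `-1` to `E₁`, whose values on `E₁` have
weight `0`. -/
def restrictE1 (Θ : Der κ k Q (-1)) : E1Dual k Q :=
  ⟨TensorProduct.map (projWtZero k Q) (projWtZero k Q) ∘ₗ Θ.1 ∘ₗ (E1 k Q).subtype, by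
    intro b b' e
    have h : Θ.1 e.1 ∈ grade₂ k Q 0 := by simpa using Θ.2.1 1 e.1 (E1_le_grade e.2)
    have h' : outer b.1 b'.1 (Θ.1 e.1) ∈ grade₂ k Q 0 := by
      simpa using outer_grade₂ (l := 0) (m := 0) b.2 b'.2 h
    refine incl₂_injective ?_
    change incl₂ k Q (TensorProduct.map _ _ (Θ.1 (b.1 * e.1 * b'.1))) =
      incl₂ k Q (TensorProduct.map _ _ (TensorProduct.map _ _ (Θ.1 e.1)))
    rw [incl₂_outer, der_neg_one_bimod Θ b.2 b'.2, incl₂_right_inv h, incl₂_right_inv h']⟩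

theorem incl₂_restrictE1 (Θ : Der κ k Q (-1)) (e : E1 k Q) :
    incl₂ k Q ((restrictE1 Θ).1 e) = Θ.1 e.1 :=
  incl₂_right_inv (by simpa using Θ.2.1 1 e.1 (E1_le_grade e.2))

theorem existsUnique_isTilde (a : Arrow1 Q) : ∃! φ : E1Dual k Q, IsTilde a φ := by
  -- Weight signs do not matter in `E₁^∨`, so either sign rule would do for `∂/∂a`. Its weight
  -- `-|a|` has to be transported along `|a| = 1`.
  obtain ⟨Θ, h, h'⟩ : ∃ Θ : Der .degreeOnly k Q (-1),
      Θ.1 (arrow k Q a.1) = idem k Q (Q.head a.1) ⊗ₜ idem k Q (Q.tail a.1) ∧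
        ∀ b, b ≠ a.1 → Θ.1 (arrow k Q b) = 0 := by
    have h := partialDer_self (k := k) (Q := Q) (κ := .degreeOnly) a.1
    have h' := fun b (hb : b ≠ a.1) => partialDer_of_ne (k := k) (Q := Q) (κ := .degreeOnly) hb
    generalize partialDer .degreeOnly k Q a.1 = Θ at h h'
    revert Θ
    rw [a.2]
    exact fun Θ h h' => ⟨Θ, h, h'⟩
  refine ⟨restrictE1 Θ, ⟨incl₂_injective ?_, fun b hb => incl₂_injective ?_⟩, ?_⟩
  · rw [incl₂_restrictE1, incl₂_tmul]
    exact h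
  · rw [incl₂_restrictE1, map_zero]
    exact h' _ fun e => hb (Subtype.ext e)
  · intro ψ hψ
    refine E1Dual.ext_arr fun b => incl₂_injective ?_
    rw [incl₂_restrictE1]
    by_cases hb : b = a
    · subst hb
      rw [hψ.1]
      exact h.symm
    · rw [hψ.2 b hb, map_zero]
      exact (h' _ fun e => hb (Subtype.ext e)).symm

theorem E1Dual.apply_arr (φ : E1Dual k Q) (a : Arrow1 Q) :
    TensorProduct.map (LinearMap.mulLeft k (idemB k Q (Q.head a.1)))
      (LinearMap.mulRight k (idemB k Q (Q.tail a.1))) (φ.1 (arr k Q a)) = φ.1 (arr k Q a) := by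
  rw [← φ.2, E1.bimod_idem]

theorem existsUnique_isLift (hQ : ∀ a, Q.wt a ≤ 2) (φ : E1Dual k Q) :
    ∃! Θ : Der κ k Q (-1), IsLift φ Θ := by
  have hT : ∀ a, (if h : Q.wt a = 1 then incl₂ k Q (φ.1 (arr k Q ⟨a, h⟩)) else 0) ∈
      grade₂ k Q (Q.wt a + -1) := by
    intro a
    split_ifs with h
    · rw [h]
      exact incl₂_mem_grade₂ _
    · exact zero_mem _
  refine ⟨freeDer κ (-1) _ hT, ⟨?_, fun a ha => ?_⟩, fun Δ hΔ => ?_⟩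
  · refine LinearMap.congr_fun (f := (freeDer κ (-1) _ hT).1 ∘ₗ (E1 k Q).subtype)
      (g := incl₂ k Q ∘ₗ φ.1) (E1.linearMap_ext fun b b' a => ?_)
    change (freeDer κ (-1) _ hT).1 (b.1 * arrow k Q a.1 * b'.1) = incl₂ k Q (φ.1 _)
    rw [der_neg_one_bimod _ b.2 b'.2, freeDer_arrow, dif_pos a.2, φ.2, incl₂_outer]
    conv_rhs => rw [← E1Dual.apply_arr, incl₂_outer]
    rfl
  · rw [freeDer_arrow, dif_neg (by omega), map_zero]
  · refine der_ext fun a => ?_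
    have h := hQ a
    rw [freeDer_arrow]
    split_ifs with h1
    · refine (hΔ.1 (arr k Q ⟨a, h1⟩)).trans ?_
      conv_lhs => rw [← E1Dual.apply_arr]
      exact incl₂_outer (idemB k Q (Q.head a)) (idemB k Q (Q.tail a)) _
    · rw [map_zero]
      by_cases h0 : Q.wt a = 0
      · refine der_neg_one_B Δ ?_
        have := arrow_mem_grade (k := k) (Q := Q) a
        rwa [h0] at this
      · exact hΔ.2 a (by omega)

/-- The projection of `A` onto its component of weight `1`. -/
def projWtOne (k : Type*) [Field k] (Q : GradedQuiver V E) : PathAlg k Q →ₗ[k] PathAlg k Q :=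
  extend fun p => if p.wt = 1 then path k p else 0

theorem projWtOne_grade {m : ℕ} {x : PathAlg k Q} (hx : x ∈ grade k Q m) :
    projWtOne k Q x = if m = 1 then x else 0 := by
  have : grade k Q m ≤ LinearMap.eqLocus (projWtOne k Q)
      (if m = 1 then LinearMap.id else 0) := by
    refine Submodule.span_le.2 ?_
    rintro _ ⟨p, rfl, rfl⟩
    rw [SetLike.mem_coe, LinearMap.mem_eqLocus]
    split_ifs with h <;> simp [projWtOne, h]
  have h := this hx
  rw [LinearMap.mem_eqLocus] at h
  rw [h]
  split_ifs <;> rfl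

theorem projWtOne_mul {b : PathAlg k Q} (hb : b ∈ B k Q) (x : PathAlg k Q) :
    projWtOne k Q (b * x) = b * projWtOne k Q x := by
  have : projWtOne k Q ∘ₗ LinearMap.mulLeft k b = LinearMap.mulLeft k b ∘ₗ projWtOne k Q := by
    refine hom_ext fun p => ?_
    have h := mul_grade (l := 0) hb (path_grade (k := k) p)
    rw [zero_add] at h
    simp only [LinearMap.comp_apply, LinearMap.mulLeft_apply, projWtOne_grade h,
      projWtOne_grade (path_grade p)]
    split_ifs <;> simp
  exact LinearMap.congr_fun this x

/-- The map `u ⊗ v ↦ u v₁` from `A ⊗_B A` to `A`, where `v₁` is the component of weight `1` of `v`,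
takes `d e = 1 ⊗ e - e ⊗ 1` to `e` if `e` has weight `1`. -/
theorem dB_injective : Function.Injective (dB (k := k) (Q := Q)) := by
  let f : RelTensor (Subalgebra.toSubmodule (B k Q)) →ₗ[k] PathAlg k Q :=
    (balanced _).liftQ (LinearMap.mul' k _ ∘ₗ LinearMap.lTensor _ (projWtOne k Q)) <| by
      refine Submodule.span_le.2 ?_
      rintro _ ⟨u, v, s, hs, rfl⟩
      simp [projWtOne_mul hs, mul_assoc]
  have hf : ∀ e : E1 k Q, f (dB e).1 = e.1 := by
    intro e
    change (LinearMap.mul' k _ ∘ₗ LinearMap.lTensor _ (projWtOne k Q))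
      (1 ⊗ₜ e.1 - e.1 ⊗ₜ 1) = e.1
    simp [projWtOne_grade (E1_le_grade e.2), projWtOne_grade (one_grade (k := k) (Q := Q))]
  intro e e' h
  exact Subtype.ext (by rw [← hf e, ← hf e', h])

/-- The map `u ⊗ v ↦ v c u` from `B ⊗ B` to `E₁`, for an arrow `c` of weight `1`. -/
def swapArr (k : Type*) [Field k] (Q : GradedQuiver V E) (c : Arrow1 Q) :
    B k Q ⊗[k] B k Q →ₗ[k] E1 k Q :=
  TensorProduct.lift (LinearMap.mk₂ k (fun u v => E1.bimod v u (arr k Q c))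
    (fun u u' v => Subtype.ext (mul_add (v.1 * arrow k Q c.1) u.1 u'.1))
    (fun r u v => Subtype.ext (mul_smul_comm r (v.1 * arrow k Q c.1) u.1))
    (fun u v v' => Subtype.ext (by
      change (v.1 + v'.1) * arrow k Q c.1 * u.1 =
        v.1 * arrow k Q c.1 * u.1 + v'.1 * arrow k Q c.1 * u.1
      rw [add_mul, add_mul]))
    (fun r u v => Subtype.ext (by
      change (r • v.1) * arrow k Q c.1 * u.1 = r • (v.1 * arrow k Q c.1 * u.1)
      rw [smul_mul_assoc, smul_mul_assoc])))

theorem swapArr_tmul (c : Arrow1 Q) (u v : B k Q) :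
    swapArr k Q c (u ⊗ₜ v) = E1.bimod v u (arr k Q c) := rfl

theorem E1.bimod_bimod (a b a' b' : B k Q) (e : E1 k Q) :
    E1.bimod a b (E1.bimod a' b' e) = E1.bimod (a * a') (b' * b) e := by
  refine Subtype.ext ?_
  change a.1 * (a'.1 * e.1 * b'.1) * b.1 = a.1 * a'.1 * e.1 * (b'.1 * b.1)
  simp only [mul_assoc]

theorem swapArr_inner (c : Arrow1 Q) (b b' : B k Q) (x : B k Q ⊗[k] B k Q) :
    swapArr k Q c (TensorProduct.map (LinearMap.mulRight k b') (LinearMap.mulLeft k b) x) =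
      E1.bimod b b' (swapArr k Q c x) := by
  have : swapArr k Q c ∘ₗ TensorProduct.map (LinearMap.mulRight k b') (LinearMap.mulLeft k b) =
      E1.bimod b b' ∘ₗ swapArr k Q c :=
    TensorProduct.ext' fun u v => by
      simp [swapArr_tmul, E1.bimod_bimod]
  exact LinearMap.congr_fun this x

theorem IsTilde.apply_swapArr_self {c : Arrow1 Q} {φ : E1Dual k Q} (h : IsTilde c φ)
    (x : B k Q ⊗[k] B k Q) :
    φ.1 (swapArr k Q c x) = TensorProduct.comm k _ _
      (TensorProduct.map (LinearMap.mulLeft k (idemB k Q (Q.tail c.1)))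
        (LinearMap.mulRight k (idemB k Q (Q.head c.1))) x) := by
  induction x using TensorProduct.induction_on with
  | zero => simp
  | add x y hx hy => simp only [map_add, hx, hy]
  | tmul u v =>
    rw [swapArr_tmul, φ.2, h.1]
    rfl

theorem IsTilde.apply_swapArr_of_ne {a c : Arrow1 Q} {φ : E1Dual k Q} (h : IsTilde c φ)
    (hac : a ≠ c) (x : B k Q ⊗[k] B k Q) : φ.1 (swapArr k Q a x) = 0 := by
  induction x using TensorProduct.induction_on with
  | zero => simp
  | add x y hx hy => simp only [map_add, hx, hy, add_zero]
  | tmul u v => rw [swapArr_tmul, φ.2, h.2 a hac, map_zero]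

theorem d_bimod_B {b b' : PathAlg k Q} (hb : b ∈ B k Q) (hb' : b' ∈ B k Q) (x : PathAlg k Q) :
    d (Subalgebra.toSubmodule (B k Q)) (b * x * b') = Om.bimod b b' (d _ x) := by
  rw [d_mul, d_mul, d_eq_zero (S := Subalgebra.toSubmodule (B k Q)) hb,
    d_eq_zero (S := Subalgebra.toSubmodule (B k Q)) hb', map_zero, map_zero, zero_add,
    add_zero, Om.bimod_bimod, one_mul, one_mul]

theorem projB_bimod_d (u v x : PathAlg k Q) :
    projB (Om.bimod u v (d _ x)) = Om.bimod u v (d (Subalgebra.toSubmodule (B k Q)) x) :=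
  Subtype.ext (factor_cls (balanced_mono R_le_B) (outer u v (1 ⊗ₜ x - x ⊗ₜ 1)))

theorem projB_swapD (c : Arrow1 Q) (x : B k Q ⊗[k] B k Q) :
    projB (swapD κ k Q c.1 (incl₂ k Q x)) = dB (swapArr k Q c x) := by
  change _ = dLin _ ((E1 k Q).subtype (swapArr k Q c x))
  induction x using TensorProduct.induction_on with
  | zero => simp
  | add x y hx hy => simp only [map_add, hx, hy]
  | tmul u v =>
    rw [incl₂_tmul, swapD_tmul (i := 0) (j := 0) u.2 v.2, sign_comm, Nat.cast_zero, sign_zero,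
      one_smul, projB_bimod_d, ← d_bimod_B v.2 u.2]
    rfl
end

section
variable {k : Type*} [Field k] {V E : Type*} [DecidableEq V] [Fintype V] [Fintype E]
  {P : GradedQuiver V E} {κ : SignRule}

/-! ### The restriction of the contraction to weight one -/

theorem star1_star1 (a : Arrow1 (P.double 2)) : star1 P (star1 P a) = a :=
  Subtype.ext (star_star a.1)

/-- The map `E₁^∨ → E₁` induced by `ι(ω)`: it sends `φ` to the sum over the arrows `a` of weight `1`
of `ε(a) v a* u`, where `φ(a) = u ⊗ v`. -/
def iotaOne (κ : SignRule) (k : Type*) [Field k] (P : GradedQuiver V E) :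
    E1Dual k (P.double 2) →ₗ[k] E1 k (P.double 2) where
  toFun φ := ∑ a : Arrow1 (P.double 2), eps κ k P 2 a.1 •
    swapArr k _ (star1 P a) (φ.1 (arr k _ a))
  map_add' φ ψ := by
    simp only [Submodule.coe_add, LinearMap.add_apply, map_add, smul_add, Finset.sum_add_distrib]
  map_smul' c φ := by
    simp only [Submodule.coe_smul, LinearMap.smul_apply, map_smul, Finset.smul_sum,
      RingHom.id_apply]
    exact Finset.sum_congr rfl fun a _ => smul_comm _ _ _

theorem iotaOne_apply (φ : E1Dual k (P.double 2)) :
    iotaOne κ k P φ = ∑ a : Arrow1 (P.double 2), eps κ k P 2 a.1 •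
      swapArr k _ (star1 P a) (φ.1 (arr k _ a)) := rfl

theorem iotaOne_bimod (b b' : B k (P.double 2)) (φ : E1Dual k (P.double 2)) :
    iotaOne κ k P (E1Dual.bimod b b' φ) = E1.bimod b b' (iotaOne κ k P φ) := by
  rw [iotaOne_apply, iotaOne_apply, map_sum]
  refine Finset.sum_congr rfl fun a _ => ?_
  rw [map_smul, ← swapArr_inner]
  rfl

theorem iotaOne_of_isTilde {a : Arrow1 (P.double 2)} {φ : E1Dual k (P.double 2)}
    (h : IsTilde a φ) : iotaOne κ k P φ = eps κ k P 2 a.1 • arr k _ (star1 P a) := by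
  rw [iotaOne_apply, Finset.sum_eq_single a]
  · rw [h.1, swapArr_tmul]
    congr 1
    have e := E1.bimod_idem (k := k) (star1 P a)
    rwa [show (P.double 2).head (star1 P a).1 = _ from GradedQuiver.double_head_star a.1,
      show (P.double 2).tail (star1 P a).1 = _ from GradedQuiver.double_tail_star a.1] at e
  · intro b _ hb
    rw [h.2 b hb, map_zero, smul_zero]
  · simp

theorem iotaOne_injective : Function.Injective (iotaOne κ k P) := by
  intro φ ψ h
  refine E1Dual.ext_arr fun a => ?_
  obtain ⟨τ, hτ, -⟩ := existsUnique_isTilde (k := k) (star1 P a)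
  -- Applying the dual element of `a*` to `iotaOne φ` isolates the value of `φ` at `a`.
  have key : ∀ φ : E1Dual k (P.double 2), τ.1 (iotaOne κ k P φ) =
      eps κ k P 2 a.1 • TensorProduct.comm k _ _ (φ.1 (arr k _ a)) := by
    intro φ
    rw [iotaOne_apply, map_sum, Finset.sum_eq_single a]
    · rw [map_smul, hτ.apply_swapArr_self,
        show (P.double 2).head (star1 P a).1 = _ from GradedQuiver.double_head_star a.1,
        show (P.double 2).tail (star1 P a).1 = _ from GradedQuiver.double_tail_star a.1,
        E1Dual.apply_arr]
    · intro b _ hb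
      rw [map_smul, hτ.apply_swapArr_of_ne, smul_zero]
      exact fun e => hb (by rw [← star1_star1 b, e, star1_star1])
    · exact fun h => absurd (Finset.mem_univ a) h
  exact (TensorProduct.comm k _ _).injective
    (eps_smul_injective a.1 ((key φ).symm.trans ((congrArg τ.1 h).trans (key ψ))))

theorem iotaOne_surjective : Function.Surjective (iotaOne κ k P) := by
  rw [← LinearMap.range_eq_top, eq_top_iff, ← E1.span_bimod_arr, Submodule.span_le]
  rintro _ ⟨b, b', a, rfl⟩
  obtain ⟨τ, hτ, -⟩ := existsUnique_isTilde (k := k) (star1 P a)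
  refine ⟨eps κ k P 2 (star1 P a).1 • E1Dual.bimod b b' τ, ?_⟩
  rw [map_smul, iotaOne_bimod, iotaOne_of_isTilde hτ, map_smul, smul_smul, eps_mul_self, one_smul,
    star1_star1]

theorem IsLift.apply_arrow_of_ne (hP : ∀ a, P.wt a ≤ 2) {φ : E1Dual k (P.double 2)}
    {Θ : Der κ k (P.double 2) (-1)} (h : IsLift φ Θ) {a : E ⊕ E} (ha : (P.double 2).wt a ≠ 1) :
    Θ.1 (arrow k _ a) = 0 := by
  have := GradedQuiver.double_wt_add_wt_star hP a
  by_cases h0 : (P.double 2).wt a = 0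
  · refine der_neg_one_B Θ ?_
    have := arrow_mem_grade (k := k) (Q := P.double 2) a
    rwa [h0] at this
  · exact h.2 a (by omega)

theorem projB_iotaForm_omega (hP : ∀ a, P.wt a ≤ 2) {φ : E1Dual k (P.double 2)}
    {Θ : Der κ k (P.double 2) (-1)} (h : IsLift φ Θ) :
    projB (iotaForm (omega κ k P 2)
      (DirectSum.lof k ℤ (fun n => Der κ k (P.double 2) n) (-1) Θ)) = dB (iotaOne κ k P φ) := by
  change _ = dLin _ ((E1 k _).subtype (iotaOne κ k P φ))
  rw [iotaForm_omega, iotaOne_apply, map_sum, map_sum, map_sum]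
  rw [← Finset.sum_filter_of_ne (p := fun a => (P.double 2).wt a = 1)]
  · rw [← Finset.sum_subtype_eq_sum_filter]
    refine Finset.sum_congr ?_ fun a _ => ?_
    · ext; simp
    · have h1 := h.1 (arr k _ a)
      change Θ.1 (arrow k _ a.1) = incl₂ k _ _ at h1
      rw [map_smul, map_smul, map_smul, h1]
      exact congrArg _ (projB_swapD (star1 P a) _)
  · intro a _ ha
    by_contra hw
    rw [h.apply_arrow_of_ne hP hw, map_zero, smul_zero, map_zero] at ha
    exact ha rfl
end

end NCQuiver

end

theorem mainTheorem4 {k : Type*} [Field k] {V E : Type*} [Fintype V] [DecidableEq V]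
    [Fintype E] (P : NCQuiver.GradedQuiver V E) (hP : ∀ a, P.wt a ≤ 2)
    (κ : NCQuiver.SignRule) :
    -- `ι(ω)` is an isomorphism of graded bimodules, of weight 2
    (Function.Bijective (NCQuiver.iotaForm (NCQuiver.omega κ k P 2)) ∧
      NCQuiver.IsGradedBimoduleMap κ 2 (NCQuiver.iotaForm (NCQuiver.omega κ k P 2))) ∧
    -- the elements `ã`, the inclusion of `E₁^∨` in the double derivations and the inclusion of
    -- `E₁` in the relative 1-forms are well defined
    (∀ a, ∃! φ : NCQuiver.E1Dual k (P.double 2), NCQuiver.IsTilde a φ) ∧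
    (∀ φ : NCQuiver.E1Dual k (P.double 2),
      ∃! Θ : NCQuiver.Der κ k (P.double 2) (-1), NCQuiver.IsLift φ Θ) ∧
    Function.Injective (NCQuiver.dB (k := k) (Q := P.double 2)) ∧
    -- the restriction in weight 1
    ∃ r : NCQuiver.E1Dual k (P.double 2) ≃ₗ[k] NCQuiver.E1 k (P.double 2),
      (∀ b b' φ, r (NCQuiver.E1Dual.bimod b b' φ) = NCQuiver.E1.bimod b b' (r φ)) ∧
      (∀ φ (Θ : NCQuiver.Der κ k (P.double 2) (-1)), NCQuiver.IsLift φ Θ →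
        NCQuiver.projB (NCQuiver.iotaForm (NCQuiver.omega κ k P 2)
          (DirectSum.lof k ℤ (fun n => NCQuiver.Der κ k (P.double 2) n) (-1) Θ)) =
            NCQuiver.dB (r φ)) ∧
      (∀ a φ (Θ : NCQuiver.Der κ k (P.double 2) (-1)), NCQuiver.IsTilde a φ →
        NCQuiver.IsLift φ Θ →
        NCQuiver.iotaForm (NCQuiver.omega κ k P 2)
          (DirectSum.lof k ℤ (fun n => NCQuiver.Der κ k (P.double 2) n) (-1) Θ) =
            NCQuiver.eps κ k P 2 a.1 •
              NCQuiver.d _ (NCQuiver.arrow k (P.double 2) (NCQuiver.star a.1))) ∧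
      (∀ a φ, NCQuiver.IsTilde a φ →
        r φ = NCQuiver.eps κ k P 2 a.1 • NCQuiver.arr k (P.double 2) (NCQuiver.star1 P a)) ∧
      (∀ a φ, NCQuiver.IsTilde (NCQuiver.star1 P a) φ →
        r.symm (NCQuiver.arr k (P.double 2) a) =
          NCQuiver.eps κ k P 2 (NCQuiver.star a.1) • φ) := by
  refine ⟨⟨⟨NCQuiver.iotaForm_omega_injective hP, NCQuiver.iotaForm_omega_surjective hP⟩,
    NCQuiver.iotaForm_omega_isGradedBimoduleMap hP⟩, NCQuiver.existsUnique_isTilde,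
    NCQuiver.existsUnique_isLift fun a => ?_, NCQuiver.dB_injective,
    LinearEquiv.ofBijective (NCQuiver.iotaOne κ k P)
      ⟨NCQuiver.iotaOne_injective, NCQuiver.iotaOne_surjective⟩,
    NCQuiver.iotaOne_bimod, fun φ Θ h => NCQuiver.projB_iotaForm_omega hP h,
    fun a φ Θ hφ hΘ => ?_, fun a φ h => NCQuiver.iotaOne_of_isTilde h, fun a φ h => ?_⟩
  · have := NCQuiver.GradedQuiver.double_wt_add_wt_star hP a
    omega
  · refine NCQuiver.iotaForm_omega_of_eq_single ?_ fun b hb => ?_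
    · refine (hΘ.1 (NCQuiver.arr k _ a)).trans ?_
      rw [hφ.1]
      rfl
    · by_cases hw : (P.double 2).wt b = 1
      · refine (hΘ.1 (NCQuiver.arr k _ ⟨b, hw⟩)).trans ?_
        rw [hφ.2 _ fun e => hb (congrArg Subtype.val e), map_zero]
      · exact NCQuiver.IsLift.apply_arrow_of_ne hP hΘ hw
  · rw [LinearEquiv.symm_apply_eq, map_smul]
    refine Eq.symm ((congrArg _ (NCQuiver.iotaOne_of_isTilde h)).trans ?_)
    rw [NCQuiver.star1_star1]
    exact (smul_smul _ _ _).trans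
      ((congrArg (· • _) (NCQuiver.eps_mul_self _)).trans (one_smul _ _))
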